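/- Let $\delta>4$, $\rho\in[0,1]$ and $c>0$. Consider dimensions $m,n\to\infty$ with $m/n\to\delta$, and for each $n$ a unit vector $x_{\rm init}\in\mathbb C^n$ with $x_{\rm init}^{\star}e_1=\rho$ (so $\rho=\rho_{\rm init}$ for the signal $x_0=e_1$). Put $$\eta=\begin{bmatrix}{\rm Re}\,x_{\rm init}\\ -{\rm Im}\,x_{\rm init}(2:n)\end{bmatrix}\in\mathbb R^{2n-1}.$$ Let $b\in\mathbb R^m$, $g\in\mathbb R^m$, $h\in\mathbb R^{2n-2}$ be random with all entries independent, the entries of $b$ Rayleigh distributed with second moment $2c$ (density $\frac{x}{c}e^{-x^2/(2c)}$ on $x>0$), and those of $g$ and $h$ distributed as $\mathcal N(0,c)$. For $w=(w_1,\tilde w)\in\mathbb R\times\mathbb R^{2n-2}$ consider the auxiliary optimization problem $$\min_{w\in\mathbb R^{2n-1}}\ \sup_{v\in\mathbb R^m}\ -\eta^Tw+v^Tg\,\|\tilde w\|+\|v\|\,h^T\tilde w+v^Tb\,(1+w_1)-|v|^Tb ,$$ where $|v|$ is the entrywise absolute value, and for an optimizer $w^*$ set $s^*=1+w_1^*$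 and $t^*=\|\tilde w^*\|$. Let $$p(t,s)=t^2+(1+s)\Bigl[1+s-\sqrt{t^2+(1+s)^2}\Bigr]+(1-s)\Bigl[1-s-\sqrt{t^2+(1-s)^2}\Bigr].$$ Then the deterministic program $$\max_{s\in[-1,1],\ t\ge 0}\ \rho s+\sqrt{1-\rho^2}\,\sqrt{t^2-\tfrac{\delta}{2}p(t,s)}\qquad\text{subject to}\quad p(t,s)\le \frac{2t^2}{\delta}$$ has a unique solution $(t_0,s_0)$, and $(t^*,s^*)\to(t_0,s_0)$ in probability: for every $\varepsilon>0$, with probability tending to $1$, the auxiliary problem has an optimizer and every optimizer satisfies $|t^*-t_0|<\varepsilon$ and $|s^*-s_0|<\varepsilon$. Moreover, $(t,s)=(0,1)$ is the unique solution of the deterministic program if and only if $\rho\ge 2/\sqrt\delta$. -/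

import Mathlib

open MeasureTheory ProbabilityTheory Filter Topology Set
open scoped NNReal ENNReal

/-! ### The auxiliary optimization problem

The signal lives in `ℂ^(k+1)`; the real problem lives in `ℝ^(2k+1)`, whose coordinates are indexed
by `Fin (k + 1) ⊕ Fin k`: the real parts of all `k + 1` entries, followed by (minus) the imaginary
parts of the entries `2, …, k+1`. -/

namespace PhaseMax

noncomputable section

/-- The vector `η = (Re x, -Im x(2:n))` of a complex vector `x`. -/
def eta {k : ℕ} (x : EuclideanSpace ℂ (Fin (k + 1))) : EuclideanSpace ℝ (Fin (k + 1) ⊕ Fin k) :=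
  WithLp.toLp 2 (Sum.elim (fun i => (x i).re) (fun i => -(x i.succ).im))

/-- The first entry `w₁` of a vector of `ℝ^(2k+1)`. -/
def headEntry {k : ℕ} (w : EuclideanSpace ℝ (Fin (k + 1) ⊕ Fin k)) : ℝ :=
  w (Sum.inl 0)

/-- The vector `w̃ ∈ ℝ^(2k)` of the remaining entries of `w`. -/
def tailPart {k : ℕ} (w : EuclideanSpace ℝ (Fin (k + 1) ⊕ Fin k)) :
    EuclideanSpace ℝ (Fin k ⊕ Fin k) :=
  WithLp.toLp 2 (Sum.elim (fun i => w (Sum.inl i.succ)) (fun i => w (Sum.inr i)))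

/-- `s = 1 + w₁`. -/
def sOf {k : ℕ} (w : EuclideanSpace ℝ (Fin (k + 1) ⊕ Fin k)) : ℝ := 1 + headEntry w

/-- `t = ‖w̃‖`. -/
def tOf {k : ℕ} (w : EuclideanSpace ℝ (Fin (k + 1) ⊕ Fin k)) : ℝ := ‖tailPart w‖

/-- The min-max objective of the auxiliary problem (AO):
`-ηᵀw + vᵀg ‖w̃‖ + ‖v‖ hᵀw̃ + vᵀb (1 + w₁) - |v|ᵀb`. -/
def aoObjective {m k : ℕ} (η : EuclideanSpace ℝ (Fin (k + 1) ⊕ Fin k))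
    (b g : Fin m → ℝ) (h : Fin k ⊕ Fin k → ℝ)
    (w : EuclideanSpace ℝ (Fin (k + 1) ⊕ Fin k)) (v : EuclideanSpace ℝ (Fin m)) : ℝ :=
  -(∑ l, η l * w l) + (∑ i, v i * g i) * ‖tailPart w‖ + ‖v‖ * (∑ l, h l * tailPart w l)
    + (∑ i, v i * b i) * (1 + headEntry w) - ∑ i, |v i| * b i

/-- The cost that is minimized in (AO): the supremum of the objective over `v ∈ ℝ^m`,
with value `⊤` where the objective is unbounded in `v`. -/
def aoCost {m k : ℕ} (η : EuclideanSpace ℝ (Fin (k + 1) ⊕ Fin k))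
    (b g : Fin m → ℝ) (h : Fin k ⊕ Fin k → ℝ)
    (w : EuclideanSpace ℝ (Fin (k + 1) ⊕ Fin k)) : EReal :=
  ⨆ v : EuclideanSpace ℝ (Fin m), (aoObjective η b g h w v : EReal)

/-- `w` is an optimizer of (AO). -/
def IsAOOptimizer {m k : ℕ} (η : EuclideanSpace ℝ (Fin (k + 1) ⊕ Fin k))
    (b g : Fin m → ℝ) (h : Fin k ⊕ Fin k → ℝ)
    (w : EuclideanSpace ℝ (Fin (k + 1) ⊕ Fin k)) : Prop :=
  ∀ w', aoCost η b g h w ≤ aoCost η b g h w'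

/-! ### The law of the random data -/

/-- The Rayleigh distribution with second moment `2 * c`:
density `x / c * exp (-x ^ 2 / (2 * c))` on the positive half-line. -/
def rayleigh (c : ℝ≥0) : Measure ℝ :=
  (volume.restrict (Ioi 0)).withDensity
    (fun x : ℝ => ENNReal.ofReal (x / c * Real.exp (-x ^ 2 / (2 * c))))

/-- The joint law of `(b, g, h)`: all coordinates are independent, those of `b ∈ ℝ^m` are Rayleigh
with second moment `2 * c`, those of `g ∈ ℝ^m` and `h ∈ ℝ^(2k)` are Gaussian `N(0, c)`. -/
def aoLaw (c : ℝ≥0) (m k : ℕ) :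
    Measure ((Fin m → ℝ) × (Fin m → ℝ) × (Fin k ⊕ Fin k → ℝ)) :=
  (Measure.pi fun _ => rayleigh c).prod
    ((Measure.pi fun _ => gaussianReal 0 c).prod (Measure.pi fun _ => gaussianReal 0 c))

/-! ### The deterministic program -/

/-- The function `p(t, s)`. -/
def pFun (t s : ℝ) : ℝ :=
  t ^ 2 + (1 + s) * (1 + s - √(t ^ 2 + (1 + s) ^ 2))
    + (1 - s) * (1 - s - √(t ^ 2 + (1 - s) ^ 2))

/-- The objective of the deterministic program. -/
def detObjective (δ ρ t s : ℝ) : ℝ :=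
  ρ * s + √(1 - ρ ^ 2) * √(t ^ 2 - δ / 2 * pFun t s)

/-- `(t, s)` is feasible for the deterministic program. -/
def DetFeasible (δ t s : ℝ) : Prop :=
  s ∈ Icc (-1) 1 ∧ 0 ≤ t ∧ pFun t s ≤ 2 * t ^ 2 / δ

/-- `(t, s)` is a solution of the deterministic program. -/
def IsDetSolution (δ ρ t s : ℝ) : Prop :=
  DetFeasible δ t s ∧ ∀ t' s', DetFeasible δ t' s' → detObjective δ ρ t' s' ≤ detObjective δ ρ t s

/-- `(t, s)` is the unique solution of the deterministic program. -/
def IsUniqueDetSolution (δ ρ t s : ℝ) : Prop :=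
  IsDetSolution δ ρ t s ∧ ∀ t' s', IsDetSolution δ ρ t' s' → t' = t ∧ s' = s

end

end PhaseMax

open PhaseMax

/-!
Write `t = ‖w̃‖`, `s = 1 + w₁`. The objective of (AO) is `-ηᵀw` plus a term that is positively
homogeneous in `v`, so the inner supremum is `-ηᵀw` or `⊤`, and (AO) maximizes `ηᵀw` over a feasible
set. With `F (t, s)` the norm of the entrywise positive part of `|t g + s b| - b`, feasibility
implies `F (t, s) ≤ |hᵀw̃|` (`AOFeasible.norm_slack_le`) and is implied by `hᵀw̃ ≤ -F (t, s)`
(`AOFeasible.of_le`). Since `h` is almost orthogonal to the tail of `η`, which has norm `√(1 - ρ²)`,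
the best `w̃` for given `t` and `s` has the value `√(1 - ρ²) √(t² - (F / ‖h‖)²)` up to a small
error.

By the law of large numbers `F² / ‖h‖² → q² = (δ / 2) p(t, s)`: the expectation
`E (|t g + s b| - b)₊² = c p(t, s)` is computed in polar coordinates (`integral_slackSq`). The
convergence is uniform on boxes because `F` is Lipschitz. Feasible points cannot escape from the box
`[0, 5] × [-5, 5]`: `F` shrinks at least linearly when its argument is scaled down, so a feasible
point outside the box would yield an almost feasible point on its boundary, where `q > t`.
Compactness and uniqueness of the deterministic solution then force the optimizers to converge
(`optimizer_close`).

On the deterministic side, `2 p = A² + B²` with `A = √(t² + (1+s)²) - (1+s)` and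
`B = √(t² + (1-s)²) - (1-s)`. Both excesses are convex, hence so is `q`, strictly except between
points with `t = 0`, and `√(t² - q²)` is concave; this gives uniqueness. With `d = 1 - s` one has
`t² - q² ≤ t² - δ B² / 4 = 2 d B - (δ / 4 - 1) B² ≤ d² / (δ / 4 - 1)`, sharp to leading order at
`(t, s) = (0, 1)`; comparing with `ρ d` gives the threshold `ρ = 2 / √δ`.
-/

/-! ### Convexity of the deterministic program -/

namespace PhaseMax

/-- The excess `√(t² + a²) - a` of the hypotenuse over one leg. It is nonnegative, positively
homogeneous and subadditive in `(t, a)`, and `p` is a sum of two squares of such excesses. -/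
noncomputable def gap (t a : ℝ) : ℝ := √(t ^ 2 + a ^ 2) - a

theorem gap_nonneg (t a : ℝ) : 0 ≤ gap t a := by
  unfold gap
  have : a ≤ √(t ^ 2 + a ^ 2) := Real.le_sqrt_of_sq_le (by nlinarith [sq_nonneg t])
  linarith

theorem gap_mul {l : ℝ} (hl : 0 ≤ l) (t a : ℝ) : gap (l * t) (l * a) = l * gap t a := by
  unfold gap
  have : (l * t) ^ 2 + (l * a) ^ 2 = l ^ 2 * (t ^ 2 + a ^ 2) := by ring
  rw [this, Real.sqrt_mul (sq_nonneg l), Real.sqrt_sq hl]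
  ring

theorem gap_sq_add (t a : ℝ) : gap t a ^ 2 + 2 * a * gap t a = t ^ 2 := by
  unfold gap
  have := Real.sq_sqrt (add_nonneg (sq_nonneg t) (sq_nonneg a))
  nlinarith

theorem sqrt_sq_add_sq_add_le (x y a b : ℝ) :
    √((x + y) ^ 2 + (a + b) ^ 2) ≤ √(x ^ 2 + a ^ 2) + √(y ^ 2 + b ^ 2) := by
  have h1 := Real.sq_sqrt (add_nonneg (sq_nonneg x) (sq_nonneg a))
  have h2 := Real.sq_sqrt (add_nonneg (sq_nonneg y) (sq_nonneg b))
  have h3 : x * y + a * b ≤ √(x ^ 2 + a ^ 2) * √(y ^ 2 + b ^ 2) := by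
    rw [← Real.sqrt_mul (by positivity)]
    exact Real.le_sqrt_of_sq_le (by nlinarith [sq_nonneg (x * b - y * a)])
  refine Real.sqrt_le_iff.2 ⟨by positivity, ?_⟩
  nlinarith

theorem sqrt_sq_add_sq_add_lt {x y a b : ℝ} (h : x * b ≠ y * a) :
    √((x + y) ^ 2 + (a + b) ^ 2) < √(x ^ 2 + a ^ 2) + √(y ^ 2 + b ^ 2) := by
  have h1 := Real.sq_sqrt (add_nonneg (sq_nonneg x) (sq_nonneg a))
  have h2 := Real.sq_sqrt (add_nonneg (sq_nonneg y) (sq_nonneg b))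
  have h4 : 0 < (x * b - y * a) ^ 2 := by
    have := sub_ne_zero.2 h
    positivity
  have h3 : x * y + a * b < √(x ^ 2 + a ^ 2) * √(y ^ 2 + b ^ 2) := by
    rw [← Real.sqrt_mul (by positivity)]
    exact Real.lt_sqrt_of_sq_lt (by nlinarith)
  have h5 : 0 ≤ √(x ^ 2 + a ^ 2) + √(y ^ 2 + b ^ 2) := by positivity
  refine lt_of_pow_lt_pow_left₀ 2 h5 ?_
  rw [Real.sq_sqrt (by positivity)]
  nlinarith

theorem gap_add_le (x y a b : ℝ) : gap (x + y) (a + b) ≤ gap x a + gap y b := by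
  have := sqrt_sq_add_sq_add_le x y a b
  unfold gap
  linarith

theorem gap_add_lt {x y a b : ℝ} (h : x * b ≠ y * a) : gap (x + y) (a + b) < gap x a + gap y b := by
  have := sqrt_sq_add_sq_add_lt h
  unfold gap
  linarith

/-- The completed squares behind the convexity of `√p`. -/
theorem pFun_eq (t s : ℝ) : pFun t s = (gap t (1 + s) ^ 2 + gap t (1 - s) ^ 2) / 2 := by
  have h1 := Real.sq_sqrt (add_nonneg (sq_nonneg t) (sq_nonneg (1 + s)))
  have h2 := Real.sq_sqrt (add_nonneg (sq_nonneg t) (sq_nonneg (1 - s)))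
  unfold pFun gap
  nlinarith

theorem pFun_nonneg (t s : ℝ) : 0 ≤ pFun t s := by
  rw [pFun_eq]; positivity

theorem continuous_pFun : Continuous fun x : ℝ × ℝ => pFun x.1 x.2 := by
  unfold pFun
  fun_prop

/-- The Euclidean norm of the two excesses of three legs `(t, a, b)`. -/
noncomputable def gapNorm (t a b : ℝ) : ℝ := √(gap t a ^ 2 + gap t b ^ 2)

theorem gapNorm_mul {l : ℝ} (hl : 0 ≤ l) (t a b : ℝ) :
    gapNorm (l * t) (l * a) (l * b) = l * gapNorm t a b := by
  unfold gapNorm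
  rw [gap_mul hl, gap_mul hl]
  have : (l * gap t a) ^ 2 + (l * gap t b) ^ 2 = l ^ 2 * (gap t a ^ 2 + gap t b ^ 2) := by ring
  rw [this, Real.sqrt_mul (sq_nonneg l), Real.sqrt_sq hl]

theorem gapNorm_add_le (t t' a a' b b' : ℝ) :
    gapNorm (t + t') (a + a') (b + b') ≤ gapNorm t a b + gapNorm t' a' b' := by
  refine le_trans (Real.sqrt_le_sqrt ?_) (sqrt_sq_add_sq_add_le _ _ _ _)
  exact add_le_add (pow_le_pow_left₀ (gap_nonneg _ _) (gap_add_le _ _ _ _) 2)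
    (pow_le_pow_left₀ (gap_nonneg _ _) (gap_add_le _ _ _ _) 2)

theorem gapNorm_add_lt {t t' a a' b b' : ℝ} (h : t * a' ≠ t' * a ∨ t * b' ≠ t' * b) :
    gapNorm (t + t') (a + a') (b + b') < gapNorm t a b + gapNorm t' a' b' := by
  refine lt_of_lt_of_le (Real.sqrt_lt_sqrt (by positivity) ?_) (sqrt_sq_add_sq_add_le _ _ _ _)
  rcases h with h | h
  · exact add_lt_add_of_lt_of_le
      (pow_lt_pow_left₀ (gap_add_lt h) (gap_nonneg _ _) two_ne_zero)
      (pow_le_pow_left₀ (gap_nonneg _ _) (gap_add_le _ _ _ _) 2)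
  · exact add_lt_add_of_le_of_lt
      (pow_le_pow_left₀ (gap_nonneg _ _) (gap_add_le _ _ _ _) 2)
      (pow_lt_pow_left₀ (gap_add_lt h) (gap_nonneg _ _) two_ne_zero)

/-- `q = √(δ p / 2)`, the deterministic limit of `F / ‖h‖`, where `F (t, s)` is the norm of the
entrywise positive part of `|t g + s b| - b`. -/
noncomputable def qFun (δ t s : ℝ) : ℝ := √(δ / 2 * pFun t s)

theorem qFun_nonneg (δ t s : ℝ) : 0 ≤ qFun δ t s := Real.sqrt_nonneg _

theorem qFun_sq {δ : ℝ} (hδ : 0 ≤ δ) (t s : ℝ) : qFun δ t s ^ 2 = δ / 2 * pFun t s :=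
  Real.sq_sqrt (mul_nonneg (by linarith) (pFun_nonneg t s))

theorem qFun_eq {δ : ℝ} (hδ : 0 ≤ δ) (t s : ℝ) :
    qFun δ t s = √(δ / 4) * gapNorm t (1 + s) (1 - s) := by
  unfold qFun gapNorm
  rw [pFun_eq, ← Real.sqrt_mul (by positivity)]
  congr 1
  ring

theorem continuous_qFun (δ : ℝ) : Continuous fun x : ℝ × ℝ => qFun δ x.1 x.2 :=
  (continuous_const.mul continuous_pFun).sqrt

theorem qFun_convex {δ : ℝ} (hδ : 0 ≤ δ) {l : ℝ} (h0 : 0 ≤ l) (h1 : l ≤ 1) (t s t' s' : ℝ) :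
    qFun δ ((1 - l) * t + l * t') ((1 - l) * s + l * s') ≤
      (1 - l) * qFun δ t s + l * qFun δ t' s' := by
  have h2 : 0 ≤ 1 - l := by linarith
  rw [qFun_eq hδ, qFun_eq hδ, qFun_eq hδ]
  have e1 : 1 + ((1 - l) * s + l * s') = (1 - l) * (1 + s) + l * (1 + s') := by ring
  have e2 : 1 - ((1 - l) * s + l * s') = (1 - l) * (1 - s) + l * (1 - s') := by ring
  have := gapNorm_add_le ((1 - l) * t) (l * t') ((1 - l) * (1 + s)) (l * (1 + s'))
    ((1 - l) * (1 - s)) (l * (1 - s'))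
  rw [gapNorm_mul h2, gapNorm_mul h0] at this
  rw [e1, e2]
  nlinarith [Real.sqrt_nonneg (δ / 4)]

/-- Equality in both triangle inequalities would make `(t, 1 + s)` and `(t, 1 - s)` proportional to
`(t', 1 + s')` and `(t', 1 - s')`, which forces equal points unless `t = t' = 0`. -/
theorem qFun_midpoint_lt {δ : ℝ} (hδ : 0 < δ) {t s t' s' : ℝ} (ht : t ≠ 0 ∨ t' ≠ 0)
    (hne : ¬ (t' = t ∧ s' = s)) :
    2 * qFun δ ((t + t') / 2) ((s + s') / 2) < qFun δ t s + qFun δ t' s' := by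
  rw [qFun_eq hδ.le, qFun_eq hδ.le, qFun_eq hδ.le]
  have key : gapNorm (t + t') ((1 + s) + (1 + s')) ((1 - s) + (1 - s')) <
      gapNorm t (1 + s) (1 - s) + gapNorm t' (1 + s') (1 - s') := by
    apply gapNorm_add_lt
    by_contra! hc
    obtain ⟨e1, e2⟩ := hc
    have e3 : t' = t := by linarith
    subst e3
    have ht' : t' ≠ 0 := by tauto
    exact hne ⟨rfl, by have := mul_left_cancel₀ ht' e1; linarith⟩
  have e : gapNorm (t + t') ((1 + s) + (1 + s')) ((1 - s) + (1 - s')) =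
      2 * gapNorm ((t + t') / 2) (1 + (s + s') / 2) (1 - (s + s') / 2) := by
    rw [← gapNorm_mul zero_le_two]
    congr 1 <;> ring
  rw [e] at key
  have h4 : 0 < √(δ / 4) := Real.sqrt_pos.2 (by linarith)
  nlinarith

/-! ### Feasible points of the deterministic program -/

theorem pFun_le_iff {δ t s : ℝ} (hδ : 0 < δ) (ht : 0 ≤ t) :
    pFun t s ≤ 2 * t ^ 2 / δ ↔ qFun δ t s ≤ t := by
  rw [le_div_iff₀ hδ, ← pow_le_pow_iff_left₀ (qFun_nonneg δ t s) ht two_ne_zero, qFun_sq hδ.le]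
  constructor <;> intro h <;> linarith

/-- The constraint `q ≤ t` already forces `|s| ≤ 1` and bounds `t`: one excess alone is larger than
`t` when `|s| > 1`, which contradicts `δ p ≤ 2 t²` because `δ > 4`. -/
theorem bounds_of_qFun_le {δ t s : ℝ} (hδ : 4 < δ) (ht : 0 ≤ t) (h : qFun δ t s ≤ t) :
    |s| ≤ 1 ∧ t ≤ 4 := by
  have hp : δ * pFun t s ≤ 2 * t ^ 2 := by
    have := pow_le_pow_left₀ (qFun_nonneg δ t s) h 2
    rw [qFun_sq (by linarith)] at this
    linarith
  have hp2 : 4 * pFun t s ≤ 2 * t ^ 2 := by nlinarith [pFun_nonneg t s]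
  rw [pFun_eq] at hp2
  have far : ∀ a : ℝ, a < 0 → t ^ 2 < gap t a ^ 2 := by
    intro a ha
    have := gap_sq_add t a
    have h0 : -a < gap t a := by
      unfold gap
      have : 0 < √(t ^ 2 + a ^ 2) := Real.sqrt_pos.2 (by nlinarith [sq_nonneg t])
      linarith
    nlinarith
  have hs : |s| ≤ 1 := by
    rw [abs_le]
    constructor <;> by_contra! hc
    · nlinarith [far (1 + s) (by linarith), sq_nonneg (gap t (1 - s))]
    · nlinarith [far (1 - s) (by linarith), sq_nonneg (gap t (1 + s))]
  refine ⟨hs, ?_⟩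
  rw [abs_le] at hs
  have near : ∀ a : ℝ, 0 ≤ a → t ^ 2 - 2 * a * t ≤ gap t a ^ 2 := by
    intro a ha
    have h1 := gap_sq_add t a
    have h2 : gap t a ≤ t := by
      unfold gap
      have : √(t ^ 2 + a ^ 2) ≤ t + a := Real.sqrt_le_iff.2 ⟨by linarith, by nlinarith⟩
      linarith
    nlinarith
  have h1 := near (1 + s) (by linarith)
  have h2 := near (1 - s) (by linarith)
  by_contra! hc
  nlinarith

theorem detFeasible_iff {δ t s : ℝ} (hδ : 4 < δ) : DetFeasible δ t s ↔ 0 ≤ t ∧ qFun δ t s ≤ t := by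
  unfold DetFeasible
  constructor
  · rintro ⟨_, h1, h2⟩
    exact ⟨h1, (pFun_le_iff (by linarith) h1).1 h2⟩
  · rintro ⟨h1, h2⟩
    exact ⟨abs_le.1 (bounds_of_qFun_le hδ h1 h2).1, h1, (pFun_le_iff (by linarith) h1).2 h2⟩

theorem detObjective_eq {δ : ℝ} (hδ : 0 ≤ δ) (ρ t s : ℝ) :
    detObjective δ ρ t s = ρ * s + √(1 - ρ ^ 2) * √(t ^ 2 - qFun δ t s ^ 2) := by
  rw [qFun_sq hδ]; rfl

theorem continuous_detObjective (δ ρ : ℝ) :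
    Continuous fun x : ℝ × ℝ => detObjective δ ρ x.1 x.2 := by
  unfold detObjective
  have := continuous_pFun
  fun_prop

/-- Close to `(0, 0)` the function `p` is of order `t⁴`, so that the constraint holds strictly. -/
theorem exists_qFun_lt {δ : ℝ} (hδ : 4 < δ) : ∃ t, 0 < t ∧ qFun δ t 0 < t := by
  have hd : 0 < √δ := Real.sqrt_pos.2 (by linarith)
  have hdd := Real.sq_sqrt (show 0 ≤ δ by linarith)
  refine ⟨1 / √δ, by positivity, ?_⟩
  set t := 1 / √δ with ht
  have ht0 : 0 < t := by positivity
  have htd : δ * t ^ 2 = 1 := by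
    rw [ht, div_pow, hdd]; field_simp
  have hg : gap t 1 ≤ t ^ 2 / 2 := by
    have h0 := gap_nonneg t 1
    have := gap_sq_add t 1
    nlinarith
  have h0 := gap_nonneg t 1
  refine lt_of_pow_lt_pow_left₀ 2 ht0.le ?_
  rw [qFun_sq (by linarith), pFun_eq]
  have h2 : gap t 1 ^ 2 ≤ (t ^ 2 / 2) ^ 2 := pow_le_pow_left₀ h0 hg 2
  norm_num
  have ht2 : 0 < t ^ 2 := by positivity
  nlinarith

/-! ### Existence and uniqueness of the deterministic solution -/

theorem isCompact_detFeasible {δ : ℝ} (hδ : 4 < δ) :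
    IsCompact {x : ℝ × ℝ | DetFeasible δ x.1 x.2} := by
  have hsub : {x : ℝ × ℝ | DetFeasible δ x.1 x.2} ⊆ Icc 0 4 ×ˢ Icc (-1) 1 := by
    rintro ⟨t, s⟩ h
    have h' := (detFeasible_iff hδ).1 h
    exact ⟨⟨h'.1, (bounds_of_qFun_le hδ h'.1 h'.2).2⟩, h.1⟩
  refine IsCompact.of_isClosed_subset (isCompact_Icc.prod isCompact_Icc) ?_ hsub
  have : {x : ℝ × ℝ | DetFeasible δ x.1 x.2} = {x | 0 ≤ x.1} ∩ {x | qFun δ x.1 x.2 ≤ x.1} := by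
    ext x
    exact detFeasible_iff hδ
  rw [this]
  exact (isClosed_le continuous_const continuous_fst).inter
    (isClosed_le (continuous_qFun δ) continuous_fst)

theorem exists_isDetSolution {δ : ℝ} (hδ : 4 < δ) (ρ : ℝ) : ∃ t s, IsDetSolution δ ρ t s := by
  obtain ⟨t, ht0, ht⟩ := exists_qFun_lt hδ
  obtain ⟨x, hx, hmax⟩ := (isCompact_detFeasible hδ).exists_isMaxOn
    ⟨(t, 0), (detFeasible_iff hδ).2 ⟨ht0.le, ht.le⟩⟩ (continuous_detObjective δ ρ).continuousOn
  exact ⟨x.1, x.2, hx, fun t' s' h => hmax (show (t', s') ∈ _ from h)⟩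

/-- Concavity of `√(t² - q²)` on the cone `0 ≤ q ≤ t`, combined with its monotonicity in `q`: a
value of `q` strictly below the average gives a strict inequality. -/
theorem sqrt_sq_sub_sq_add_lt {t q t' q' r : ℝ} (hq : 0 ≤ q) (hq' : 0 ≤ q') (hr : 0 ≤ r)
    (hqt : q ≤ t) (hqt' : q' ≤ t') (h : 2 * r < q + q') :
    √(t ^ 2 - q ^ 2) + √(t' ^ 2 - q' ^ 2) < 2 * √(((t + t') / 2) ^ 2 - r ^ 2) := by
  have h1 : 0 ≤ t ^ 2 - q ^ 2 := by nlinarith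
  have h2 : 0 ≤ t' ^ 2 - q' ^ 2 := by nlinarith
  have h3 : √(t ^ 2 - q ^ 2) * √(t' ^ 2 - q' ^ 2) ≤ t * t' - q * q' := by
    rw [← Real.sqrt_mul h1]
    refine Real.sqrt_le_iff.2 ⟨by nlinarith, ?_⟩
    nlinarith [sq_nonneg (t * q' - t' * q)]
  have e1 := Real.sq_sqrt h1
  have e2 := Real.sq_sqrt h2
  have h4 : 4 * r ^ 2 < (q + q') ^ 2 := by nlinarith
  have h5 : 0 ≤ ((t + t') / 2) ^ 2 - r ^ 2 := by nlinarith
  refine lt_of_pow_lt_pow_left₀ 2 (by positivity) ?_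
  rw [mul_pow, Real.sq_sqrt h5]
  nlinarith

theorem detFeasible_zero_one {δ : ℝ} (hδ : 4 < δ) : DetFeasible δ 0 1 := by
  rw [detFeasible_iff hδ]
  refine ⟨le_rfl, ?_⟩
  rw [qFun, pFun]
  norm_num

theorem isDetSolution_unique {δ ρ t s t' s' : ℝ} (hδ : 4 < δ) (hρ : ρ ∈ Icc (0 : ℝ) 1)
    (h : IsDetSolution δ ρ t s) (h' : IsDetSolution δ ρ t' s') : t' = t ∧ s' = s := by
  have hV : detObjective δ ρ t' s' = detObjective δ ρ t s :=
    le_antisymm (h.2 _ _ h'.1) (h'.2 _ _ h.1)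
  have hδ0 : 0 < δ := by linarith
  obtain ⟨ht, hq⟩ := (detFeasible_iff hδ).1 h.1
  obtain ⟨ht', hq'⟩ := (detFeasible_iff hδ).1 h'.1
  rcases eq_or_lt_of_le hρ.2 with rfl | hρ1
  · -- for `ρ = 1` the objective is `s`, and `s = 1` is only feasible with `t = 0`
    have hobj : ∀ t s, detObjective δ 1 t s = s := by intro t s; simp [detObjective]
    have main : ∀ t s, IsDetSolution δ 1 t s → t = 0 ∧ s = 1 := by
      intro t s h
      have hs : s = 1 := by
        have := h.2 _ _ (detFeasible_zero_one hδ)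
        rw [hobj, hobj] at this
        exact le_antisymm h.1.1.2 this
      subst hs
      refine ⟨?_, rfl⟩
      by_contra hne
      have hp := h.1.2.2
      rw [le_div_iff₀ hδ0, pFun_eq] at hp
      have e : gap t (1 - 1) ^ 2 = t ^ 2 := by have := gap_sq_add t (1 - 1); linarith
      have : 0 < t ^ 2 := by positivity
      rw [e] at hp
      nlinarith [mul_nonneg hδ0.le (sq_nonneg (gap t (1 + 1))), mul_pos (sub_pos.2 hδ) this]
    have m1 := main _ _ h
    have m2 := main _ _ h'
    exact ⟨by rw [m1.1, m2.1], by rw [m1.2, m2.2]⟩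
  · have hc : 0 < √(1 - ρ ^ 2) := Real.sqrt_pos.2 (by nlinarith [hρ.1])
    rw [detObjective_eq hδ0.le, detObjective_eq hδ0.le] at hV
    by_cases h0 : t ≠ 0 ∨ t' ≠ 0
    · -- otherwise the midpoint would be feasible with a larger objective
      by_contra hne
      have hmid := qFun_midpoint_lt hδ0 h0 hne
      have hf : DetFeasible δ ((t + t') / 2) ((s + s') / 2) :=
        (detFeasible_iff hδ).2 ⟨by linarith, by linarith⟩
      have hle := h.2 _ _ hf
      rw [detObjective_eq hδ0.le, detObjective_eq hδ0.le] at hle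
      have := sqrt_sq_sub_sq_add_lt (qFun_nonneg δ t s) (qFun_nonneg δ t' s')
        (qFun_nonneg δ _ _) hq hq' hmid
      nlinarith
    · push Not at h0
      obtain ⟨rfl, rfl⟩ := h0
      refine ⟨rfl, ?_⟩
      have z : ∀ s, √((0 : ℝ) ^ 2 - qFun δ 0 s ^ 2) = 0 := fun s =>
        Real.sqrt_eq_zero_of_nonpos (by nlinarith [sq_nonneg (qFun δ 0 s)])
      rw [z, z] at hV
      have hρ0 : ρ ≠ 0 := by
        rintro rfl
        obtain ⟨t1, ht1, hq1⟩ := exists_qFun_lt hδ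
        have := h.2 t1 0 ((detFeasible_iff hδ).2 ⟨ht1.le, hq1.le⟩)
        rw [detObjective_eq hδ0.le, detObjective_eq hδ0.le, z] at this
        have hp : 0 < √(t1 ^ 2 - qFun δ t1 0 ^ 2) :=
          Real.sqrt_pos.2 (by nlinarith [qFun_nonneg δ t1 0])
        nlinarith
      exact mul_left_cancel₀ hρ0 (by linarith)

theorem IsDetSolution.isUnique {δ ρ t s : ℝ} (hδ : 4 < δ) (hρ : ρ ∈ Icc (0 : ℝ) 1)
    (h : IsDetSolution δ ρ t s) : IsUniqueDetSolution δ ρ t s :=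
  ⟨h, fun _ _ h' => isDetSolution_unique hδ hρ h h'⟩

/-! ### The phase transition -/

theorem detObjective_zero_one (δ ρ : ℝ) : detObjective δ ρ 0 1 = ρ := by
  unfold detObjective pFun
  norm_num

theorem two_div_sqrt_le_iff {δ ρ : ℝ} (hδ : 4 < δ) (hρ : 0 ≤ ρ) :
    2 / √δ ≤ ρ ↔ 4 ≤ δ * ρ ^ 2 := by
  have hd : 0 < √δ := Real.sqrt_pos.2 (by linarith)
  have hdd := Real.sq_sqrt (show 0 ≤ δ by linarith)
  rw [div_le_iff₀ hd, ← pow_le_pow_iff_left₀ zero_le_two (by positivity) two_ne_zero, mul_pow, hdd]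
  constructor <;> intro h <;> linarith

/-- In terms of `d = 1 - s` and `y = √(t² + d²) - d` one has
`t² - δ y² / 4 = 2 d y - (δ / 4 - 1) y²`, whose maximum over `y` is `d² / (δ / 4 - 1)`. -/
theorem isDetSolution_zero_one_of_le {δ ρ : ℝ} (hδ : 4 < δ) (hρ : ρ ∈ Icc (0 : ℝ) 1)
    (h : 4 ≤ δ * ρ ^ 2) : IsDetSolution δ ρ 0 1 := by
  refine ⟨detFeasible_zero_one hδ, fun t s hf => ?_⟩
  rw [detObjective_zero_one, detObjective]
  have hs := hf.1.2
  have hρ2 : 0 ≤ 1 - ρ ^ 2 := by nlinarith [hρ.1, hρ.2]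
  have key : √(1 - ρ ^ 2) * √(t ^ 2 - δ / 2 * pFun t s) ≤ ρ * (1 - s) := by
    rw [← Real.sqrt_mul hρ2]
    refine Real.sqrt_le_iff.2 ⟨mul_nonneg hρ.1 (by linarith), ?_⟩
    rw [pFun_eq]
    set d := 1 - s
    set y := gap t d
    have hy : y ^ 2 + 2 * d * y = t ^ 2 := gap_sq_add t d
    have hd : 0 ≤ d := by simp only [d]; linarith
    have h1 : t ^ 2 - δ / 2 * ((gap t (1 + s) ^ 2 + y ^ 2) / 2) ≤
        2 * d * y - (δ / 4 - 1) * y ^ 2 := by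
      nlinarith [sq_nonneg (gap t (1 + s))]
    refine (mul_le_mul_of_nonneg_left h1 hρ2).trans ?_
    have hκ : 0 < δ / 4 - 1 := by linarith
    have h2 : (1 - ρ ^ 2) ≤ ρ ^ 2 * (δ / 4 - 1) := by linarith
    have h3 : (δ / 4 - 1) * (2 * d * y - (δ / 4 - 1) * y ^ 2) ≤ d ^ 2 := by
      nlinarith [sq_nonneg (d - (δ / 4 - 1) * y)]
    have h4 : (1 - ρ ^ 2) * ((δ / 4 - 1) * (2 * d * y - (δ / 4 - 1) * y ^ 2)) ≤
        (ρ ^ 2 * (δ / 4 - 1)) * d ^ 2 :=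
      (mul_le_mul_of_nonneg_left h3 hρ2).trans (mul_le_mul_of_nonneg_right h2 (sq_nonneg d))
    refine le_of_mul_le_mul_left ?_ hκ
    linarith
  linarith

theorem le_of_isDetSolution_zero_one {δ ρ : ℝ} (hδ : 4 < δ)
    (h : IsDetSolution δ ρ 0 1) : 4 ≤ δ * ρ ^ 2 := by
  by_contra! hlt
  set κ := δ / 4 - 1 with hκ
  have hκ0 : 0 < κ := by rw [hκ]; linarith
  have hρ2 : 0 < 1 - ρ ^ 2 := by nlinarith
  -- `d = 1 - s` small, and `t` such that `√(t² + d²) - d = d / κ`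
  have hpt : ∀ d : ℝ, 0 < d → d ≤ 1 →
      d ^ 2 / κ - δ / 4 * (d ^ 2 / κ ^ 2 + 2 * d ^ 2 / κ) ^ 2 / 4 ≤ (ρ * d) ^ 2 / (1 - ρ ^ 2) := by
    intro d hd hd1
    set y := d / κ with hy
    have hy0 : 0 < y := by positivity
    set t := √(y ^ 2 + 2 * d * y) with ht
    have htt : t ^ 2 = y ^ 2 + 2 * d * y := Real.sq_sqrt (by positivity)
    have hg : gap t d = y := by
      have : t ^ 2 + d ^ 2 = (y + d) ^ 2 := by rw [htt]; ring
      rw [gap, this, Real.sqrt_sq (by positivity)]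
      ring
    have hg2 : gap t (1 + (1 - d)) ≤ t ^ 2 / 2 := by
      have e := gap_sq_add t (1 + (1 - d))
      have := gap_nonneg t (1 + (1 - d))
      nlinarith [sq_nonneg (gap t (1 + (1 - d)))]
    have hq : t ^ 2 - δ / 2 * pFun t (1 - d) =
        d ^ 2 / κ - δ / 4 * gap t (1 + (1 - d)) ^ 2 := by
      rw [pFun_eq]
      have e1 : 1 - (1 - d) = d := by ring
      have e2 : δ = 4 * (κ + 1) := by rw [hκ]; ring
      rw [e1, hg, htt, e2, hy]
      field_simp
      ring
    have hlow : d ^ 2 / κ - δ / 4 * (d ^ 2 / κ ^ 2 + 2 * d ^ 2 / κ) ^ 2 / 4 ≤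
        t ^ 2 - δ / 2 * pFun t (1 - d) := by
      rw [hq]
      have e : d ^ 2 / κ ^ 2 + 2 * d ^ 2 / κ = t ^ 2 := by rw [htt, hy]; field_simp
      rw [e]
      have := pow_le_pow_left₀ (gap_nonneg _ _) hg2 2
      nlinarith
    refine hlow.trans ?_
    rw [le_div_iff₀ hρ2]
    by_cases hneg : t ^ 2 - δ / 2 * pFun t (1 - d) ≤ 0
    · nlinarith [sq_nonneg (ρ * d)]
    push Not at hneg
    have hfe : DetFeasible δ t (1 - d) := by
      refine ⟨⟨by linarith, by linarith⟩, Real.sqrt_nonneg _, ?_⟩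
      rw [le_div_iff₀ (by linarith)]
      linarith
    have hle := h.2 _ _ hfe
    rw [detObjective_zero_one, detObjective] at hle
    have h1 : √(1 - ρ ^ 2) * √(t ^ 2 - δ / 2 * pFun t (1 - d)) ≤ ρ * d := by linarith
    have h2 := pow_le_pow_left₀ (by positivity) h1 2
    rw [mul_pow, Real.sq_sqrt hρ2.le, Real.sq_sqrt hneg.le] at h2
    linarith
  -- divide by `d²` and let `d → 0`
  set M := δ / 4 * (1 / κ ^ 2 + 2 / κ) ^ 2 / 4 with hM
  have hlim : ∀ d : ℝ, 0 < d → d ≤ 1 → 1 / κ - ρ ^ 2 / (1 - ρ ^ 2) ≤ M * d ^ 2 := by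
    intro d hd hd1
    have h1 := hpt d hd hd1
    have e : d ^ 2 * (1 / κ - ρ ^ 2 / (1 - ρ ^ 2)) - d ^ 2 * (M * d ^ 2) =
        d ^ 2 / κ - δ / 4 * (d ^ 2 / κ ^ 2 + 2 * d ^ 2 / κ) ^ 2 / 4 -
          (ρ * d) ^ 2 / (1 - ρ ^ 2) := by
      rw [hM]
      field_simp
      ring
    have : 0 < d ^ 2 := by positivity
    refine le_of_mul_le_mul_left ?_ this
    linarith
  have hpos : 0 < 1 / κ - ρ ^ 2 / (1 - ρ ^ 2) := by
    rw [sub_pos, div_lt_div_iff₀ hρ2 hκ0, hκ]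
    linarith
  have hM0 : Tendsto (fun d : ℝ => M * d ^ 2) (𝓝[>] 0) (𝓝 0) := by
    have : Tendsto (fun d : ℝ => M * d ^ 2) (𝓝 0) (𝓝 (M * 0 ^ 2)) :=
      (by fun_prop : Continuous fun d : ℝ => M * d ^ 2).tendsto 0
    rw [zero_pow two_ne_zero, mul_zero] at this
    exact this.mono_left nhdsWithin_le_nhds
  have hev : ∀ᶠ d : ℝ in 𝓝[>] 0, 1 / κ - ρ ^ 2 / (1 - ρ ^ 2) ≤ M * d ^ 2 := by
    filter_upwards [Ioc_mem_nhdsGT (zero_lt_one' ℝ)] with d hd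
    exact hlim d hd.1 hd.2
  linarith [ge_of_tendsto hM0 hev]

theorem isUniqueDetSolution_zero_one_iff {δ ρ : ℝ} (hδ : 4 < δ) (hρ : ρ ∈ Icc (0 : ℝ) 1) :
    IsUniqueDetSolution δ ρ 0 1 ↔ 2 / √δ ≤ ρ := by
  rw [two_div_sqrt_le_iff hδ hρ.1]
  exact ⟨fun h => le_of_isDetSolution_zero_one hδ h.1,
    fun h => (isDetSolution_zero_one_of_le hδ hρ h).isUnique hδ hρ⟩

/-! ### Stability of the deterministic solution -/

/-- Near-feasible points stay away from the boundary of the box `[0, 5] × [-5, 5]`, and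
near-feasible and near-optimal points of that box are close to the solution. -/
theorem IsDetSolution.exists_stable {δ ρ t₀ s₀ : ℝ} (hδ : 4 < δ) (hρ : ρ ∈ Icc (0 : ℝ) 1)
    (h : IsDetSolution δ ρ t₀ s₀) {ε : ℝ} (hε : 0 < ε) :
    ∃ γ : ℝ, 0 < γ ∧ ∀ t ∈ Icc (0 : ℝ) 5, ∀ s ∈ Icc (-5 : ℝ) 5, qFun δ t s ≤ t + γ →
      (t < 5 ∧ |s| < 5) ∧
      (detObjective δ ρ t₀ s₀ - γ ≤ detObjective δ ρ t s → |t - t₀| < ε ∧ |s - s₀| < ε) := by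
  have hK : IsCompact (Icc (0 : ℝ) 5 ×ˢ Icc (-5 : ℝ) 5) := isCompact_Icc.prod isCompact_Icc
  have hcq : Continuous fun x : ℝ × ℝ => qFun δ x.1 x.2 - x.1 :=
    (continuous_qFun δ).sub continuous_fst
  have hco := continuous_detObjective δ ρ
  have pos : ∀ (f : ℝ × ℝ → ℝ), Continuous f → ∀ C : Set (ℝ × ℝ), IsClosed C →
      (∀ x ∈ (Icc (0 : ℝ) 5 ×ˢ Icc (-5 : ℝ) 5) ∩ C, 0 < f x) →
      ∃ γ : ℝ, 0 < γ ∧ ∀ x ∈ (Icc (0 : ℝ) 5 ×ˢ Icc (-5 : ℝ) 5) ∩ C, γ < f x := by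
    intro f hf C hC hpos
    rcases ((Icc (0 : ℝ) 5 ×ˢ Icc (-5 : ℝ) 5) ∩ C).eq_empty_or_nonempty with he | hne
    · exact ⟨1, one_pos, fun x hx => absurd hx (by rw [he]; exact notMem_empty x)⟩
    · obtain ⟨x, hx, hmin⟩ := (hK.inter_right hC).exists_isMinOn hne hf.continuousOn
      have := hpos x hx
      exact ⟨f x / 2, by linarith, fun y hy => by have : f x ≤ f y := hmin hy; linarith⟩
  obtain ⟨γ₁, hγ₁, H1⟩ := pos (fun x => qFun δ x.1 x.2 - x.1) hcq {x | 5 ≤ x.1 ∨ 5 ≤ |x.2|}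
    ((isClosed_le continuous_const continuous_fst).union
      (isClosed_le continuous_const continuous_snd.abs)) (by
    rintro ⟨t, s⟩ ⟨⟨ht, _⟩, hb⟩
    by_contra! hc
    have hc' : qFun δ t s ≤ t := by simpa using hc
    have := bounds_of_qFun_le hδ ht.1 hc'
    rcases hb with hb | hb
    · exact absurd (show 5 ≤ t from hb) (by linarith)
    · exact absurd (show 5 ≤ |s| from hb) (by linarith))
  obtain ⟨γ₂, hγ₂, H2⟩ := pos
    (fun x => max (qFun δ x.1 x.2 - x.1) (detObjective δ ρ t₀ s₀ - detObjective δ ρ x.1 x.2))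
    (hcq.max (continuous_const.sub hco)) {x | ε ≤ |x.1 - t₀| ∨ ε ≤ |x.2 - s₀|}
    ((isClosed_le continuous_const (continuous_fst.sub continuous_const).abs).union
      (isClosed_le continuous_const (continuous_snd.sub continuous_const).abs)) (by
    rintro ⟨t, s⟩ ⟨⟨ht, _⟩, hb⟩
    by_contra! hc
    rw [max_le_iff] at hc
    have hq : qFun δ t s ≤ t := by linarith [hc.1]
    have ho : detObjective δ ρ t₀ s₀ ≤ detObjective δ ρ t s := by linarith [hc.2]
    have hsol : IsDetSolution δ ρ t s :=
      ⟨(detFeasible_iff hδ).2 ⟨ht.1, hq⟩, fun t' s' hf => (h.2 t' s' hf).trans ho⟩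
    obtain ⟨rfl, rfl⟩ := isDetSolution_unique hδ hρ h hsol
    simp at hb
    linarith)
  refine ⟨min γ₁ γ₂, lt_min hγ₁ hγ₂, fun t ht s hs hq => ⟨?_, fun ho => ?_⟩⟩
  · by_contra! hc
    have := H1 (t, s) ⟨⟨ht, hs⟩, by
      by_cases h5 : t < 5
      · exact Or.inr (hc h5)
      · exact Or.inl (not_lt.1 h5)⟩
    have := min_le_left γ₁ γ₂
    simp only at *
    linarith
  · by_contra! hc
    have := H2 (t, s) ⟨⟨ht, hs⟩, by
      by_cases h5 : |t - t₀| < ε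
      · exact Or.inr (hc h5)
      · exact Or.inl (not_lt.1 h5)⟩
    have hm := min_le_right γ₁ γ₂
    rcases lt_max_iff.1 this with h1 | h1 <;> simp only at h1 <;> linarith

/-- Moving from the solution slightly towards a strictly feasible point gives strictly feasible
points that are almost optimal. -/
theorem IsDetSolution.exists_strict {δ ρ t₀ s₀ : ℝ} (hδ : 4 < δ)
    (h : IsDetSolution δ ρ t₀ s₀) {κ : ℝ} (hκ : 0 < κ) :
    ∃ t s, 0 ≤ t ∧ qFun δ t s < t ∧ detObjective δ ρ t₀ s₀ - κ < detObjective δ ρ t s := by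
  obtain ⟨t₁, ht₁, hq₁⟩ := exists_qFun_lt hδ
  obtain ⟨ht₀, hq₀⟩ := (detFeasible_iff hδ).1 h.1
  have hc : Continuous fun l : ℝ =>
      detObjective δ ρ ((1 - l) * t₀ + l * t₁) ((1 - l) * s₀ + l * 0) :=
    (continuous_detObjective δ ρ).comp
      (by fun_prop : Continuous fun l : ℝ => ((1 - l) * t₀ + l * t₁, (1 - l) * s₀ + l * 0))
  have hlim := hc.tendsto 0
  simp only [sub_zero, one_mul, zero_mul, add_zero] at hlim
  have hev := (hlim.mono_left (nhdsWithin_le_nhds (s := Ioi 0))).eventually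
    (lt_mem_nhds (show detObjective δ ρ t₀ s₀ - κ < detObjective δ ρ t₀ s₀ by linarith))
  obtain ⟨l, hl, hl0, hl1⟩ := (hev.and (Ioc_mem_nhdsGT (zero_lt_one' ℝ))).exists
  refine ⟨(1 - l) * t₀ + l * t₁, (1 - l) * s₀ + l * 0, ?_, ?_, ?_⟩
  · have : 0 ≤ (1 - l) * t₀ := mul_nonneg (by linarith) ht₀
    positivity
  · have := qFun_convex (show 0 ≤ δ by linarith) hl0.le hl1 t₀ s₀ t₁ 0
    nlinarith
  · simpa using hl

end PhaseMax

/-! ### Solving the inner maximization -/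

namespace PhaseMax

variable {m k : ℕ}

/-- The part of the objective of (AO) that is positively homogeneous in `v` is nonpositive, that
is, the supremum over `v` is finite. -/
def AOFeasible (b g : Fin m → ℝ) (h : Fin k ⊕ Fin k → ℝ)
    (w : EuclideanSpace ℝ (Fin (k + 1) ⊕ Fin k)) : Prop :=
  ∀ v : EuclideanSpace ℝ (Fin m), (∑ i, v i * g i) * tOf w + ‖v‖ * (∑ l, h l * tailPart w l)
    + (∑ i, v i * b i) * sOf w - ∑ i, |v i| * b i ≤ 0

theorem aoObjective_smul (η : EuclideanSpace ℝ (Fin (k + 1) ⊕ Fin k)) (b g : Fin m → ℝ)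
    (h : Fin k ⊕ Fin k → ℝ) (w : EuclideanSpace ℝ (Fin (k + 1) ⊕ Fin k))
    (v : EuclideanSpace ℝ (Fin m)) {r : ℝ} (hr : 0 ≤ r) :
    aoObjective η b g h w (r • v) = -(∑ l, η l * w l) +
      r * ((∑ i, v i * g i) * tOf w + ‖v‖ * (∑ l, h l * tailPart w l)
        + (∑ i, v i * b i) * sOf w - ∑ i, |v i| * b i) := by
  unfold aoObjective tOf sOf
  simp only [PiLp.smul_apply, smul_eq_mul, abs_mul, abs_of_nonneg hr, norm_smul, Real.norm_eq_abs,
    mul_assoc, ← Finset.mul_sum]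
  ring

theorem aoCost_of_feasible {η : EuclideanSpace ℝ (Fin (k + 1) ⊕ Fin k)} {b g : Fin m → ℝ}
    {h : Fin k ⊕ Fin k → ℝ} {w : EuclideanSpace ℝ (Fin (k + 1) ⊕ Fin k)}
    (hw : AOFeasible b g h w) : aoCost η b g h w = ((-(∑ l, η l * w l) : ℝ) : EReal) := by
  unfold aoCost
  refine le_antisymm (iSup_le fun v => ?_) ?_
  · rw [EReal.coe_le_coe_iff, ← one_smul ℝ v, aoObjective_smul η b g h w v zero_le_one]
    have := hw v
    linarith
  · have := aoObjective_smul η b g h w 0 le_rfl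
    rw [zero_smul, zero_mul, add_zero] at this
    rw [← this]
    exact le_iSup (fun v : EuclideanSpace ℝ (Fin m) => (aoObjective η b g h w v : EReal)) 0

theorem aoCost_of_not_feasible {η : EuclideanSpace ℝ (Fin (k + 1) ⊕ Fin k)} {b g : Fin m → ℝ}
    {h : Fin k ⊕ Fin k → ℝ} {w : EuclideanSpace ℝ (Fin (k + 1) ⊕ Fin k)}
    (hw : ¬ AOFeasible b g h w) : aoCost η b g h w = ⊤ := by
  unfold AOFeasible at hw
  push Not at hw
  obtain ⟨v, hv⟩ := hw
  set D := (∑ i, v i * g i) * tOf w + ‖v‖ * (∑ l, h l * tailPart w l)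
    + (∑ i, v i * b i) * sOf w - ∑ i, |v i| * b i with hD
  rw [EReal.eq_top_iff_forall_lt]
  intro y
  set r := max 0 ((y + 1 + ∑ l, η l * w l) / D) with hr
  have h1 : y < aoObjective η b g h w (r • v) := by
    rw [aoObjective_smul η b g h w v (le_max_left _ _), ← hD]
    have : (y + 1 + ∑ l, η l * w l) ≤ r * D := by
      rw [← div_le_iff₀ hv]
      exact le_max_right _ _
    linarith
  exact lt_of_lt_of_le (EReal.coe_lt_coe_iff.2 h1)
    (le_iSup (fun v : EuclideanSpace ℝ (Fin m) => (aoObjective η b g h w v : EReal)) (r • v))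

theorem isAOOptimizer_iff {η : EuclideanSpace ℝ (Fin (k + 1) ⊕ Fin k)} {b g : Fin m → ℝ}
    {h : Fin k ⊕ Fin k → ℝ} {w w₀ : EuclideanSpace ℝ (Fin (k + 1) ⊕ Fin k)}
    (hw₀ : AOFeasible b g h w₀) :
    IsAOOptimizer η b g h w ↔ AOFeasible b g h w ∧
      ∀ w', AOFeasible b g h w' → ∑ l, η l * w' l ≤ ∑ l, η l * w l := by
  constructor
  · intro hopt
    have hw : AOFeasible b g h w := by
      by_contra hn
      have := hopt w₀
      rw [aoCost_of_not_feasible hn, aoCost_of_feasible hw₀] at this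
      exact absurd this (not_le.2 (EReal.coe_lt_top _))
    refine ⟨hw, fun w' hw' => ?_⟩
    have := hopt w'
    rw [aoCost_of_feasible hw, aoCost_of_feasible hw', EReal.coe_le_coe_iff] at this
    linarith
  · rintro ⟨hw, hmax⟩ w'
    by_cases hw' : AOFeasible b g h w'
    · rw [aoCost_of_feasible hw, aoCost_of_feasible hw', EReal.coe_le_coe_iff]
      have := hmax w' hw'
      linarith
    · rw [aoCost_of_not_feasible hw']
      exact le_top

/-- The entrywise positive part of `|t g + s b| - b`. -/
noncomputable def slack (b g : Fin m → ℝ) (t s : ℝ) : EuclideanSpace ℝ (Fin m) :=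
  WithLp.toLp 2 fun i => max (|g i * t + b i * s| - b i) 0

theorem slack_apply (b g : Fin m → ℝ) (t s : ℝ) (i : Fin m) :
    slack b g t s i = max (|g i * t + b i * s| - b i) 0 := rfl

theorem norm_sq_slack (b g : Fin m → ℝ) (t s : ℝ) :
    ‖slack b g t s‖ ^ 2 = ∑ i, (max (|g i * t + b i * s| - b i) 0) ^ 2 := by
  rw [EuclideanSpace.norm_sq_eq]
  simp [slack_apply]

/-- The absolute value covers the case of a vanishing slack, where `hᵀw̃` may be positive. -/
theorem AOFeasible.norm_slack_le {b g : Fin m → ℝ} {h : Fin k ⊕ Fin k → ℝ}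
    {w : EuclideanSpace ℝ (Fin (k + 1) ⊕ Fin k)} (hw : AOFeasible b g h w) :
    ‖slack b g (tOf w) (sOf w)‖ ≤ |∑ l, h l * tailPart w l| := by
  -- test with the vector of absolute values `slack` and the signs of `t g + s b`
  set u := slack b g (tOf w) (sOf w) with hu
  let y : Fin m → ℝ := fun i => g i * tOf w + b i * sOf w
  let v : EuclideanSpace ℝ (Fin m) :=
    WithLp.toLp 2 fun i => if 0 ≤ y i then u i else -u i
  have hu0 : ∀ i, 0 ≤ u i := fun i => le_max_right _ _
  have hva : ∀ i, |v i| = u i := by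
    intro i
    change |if 0 ≤ y i then u i else -u i| = u i
    split_ifs
    · exact abs_of_nonneg (hu0 i)
    · rw [abs_neg, abs_of_nonneg (hu0 i)]
  have hvy : ∀ i, v i * y i = u i * |y i| := by
    intro i
    change (if 0 ≤ y i then u i else -u i) * y i = u i * |y i|
    split_ifs with hy
    · rw [abs_of_nonneg hy]
    · rw [abs_of_neg (not_le.1 hy)]; ring
  have hvn : ‖v‖ = ‖u‖ := by
    rw [EuclideanSpace.norm_eq, EuclideanSpace.norm_eq]
    congr 1
    refine Finset.sum_congr rfl fun i _ => ?_
    rw [Real.norm_eq_abs, hva, Real.norm_eq_abs, abs_of_nonneg (hu0 i)]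
  have huu : ∀ i, u i * |y i| - u i * b i = u i ^ 2 := by
    intro i
    change max (|y i| - b i) 0 * |y i| - max (|y i| - b i) 0 * b i = max (|y i| - b i) 0 ^ 2
    rcases le_total (|y i| - b i) 0 with h0 | h0
    · rw [max_eq_right h0]; ring
    · rw [max_eq_left h0]; ring
  have hsum : (∑ i, v i * g i) * tOf w + (∑ i, v i * b i) * sOf w - ∑ i, |v i| * b i =
      ‖u‖ ^ 2 := by
    rw [EuclideanSpace.norm_sq_eq, Finset.sum_mul, Finset.sum_mul, ← Finset.sum_add_distrib,
      ← Finset.sum_sub_distrib]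
    refine Finset.sum_congr rfl fun i _ => ?_
    have h1 := hvy i
    have h2 := huu i
    rw [hva, Real.norm_eq_abs, sq_abs, ← h2, ← h1]
    simp only [y]
    ring
  have := hw v
  rw [hvn] at this
  rcases eq_or_lt_of_le (norm_nonneg u) with h0 | h0
  · rw [← h0]; exact abs_nonneg _
  · have h1 : ‖u‖ * (‖u‖ + ∑ l, h l * tailPart w l) ≤ 0 := by nlinarith
    have h2 : ‖u‖ + ∑ l, h l * tailPart w l ≤ 0 := by
      by_contra! hc
      nlinarith [mul_pos h0 hc]
    have := neg_le_abs (∑ l, h l * tailPart w l)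
    linarith

theorem AOFeasible.of_le {b g : Fin m → ℝ} {h : Fin k ⊕ Fin k → ℝ}
    {w : EuclideanSpace ℝ (Fin (k + 1) ⊕ Fin k)}
    (hw : ∑ l, h l * tailPart w l ≤ -‖slack b g (tOf w) (sOf w)‖) : AOFeasible b g h w := by
  intro v
  set u := slack b g (tOf w) (sOf w) with hu
  have h1 : (∑ i, v i * g i) * tOf w + (∑ i, v i * b i) * sOf w - ∑ i, |v i| * b i ≤
      ∑ i, |v i| * u i := by
    rw [Finset.sum_mul, Finset.sum_mul, ← Finset.sum_add_distrib, ← Finset.sum_sub_distrib]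
    refine Finset.sum_le_sum fun i _ => ?_
    have e : |v i| * (|g i * tOf w + b i * sOf w| - b i) ≤ |v i| * u i :=
      mul_le_mul_of_nonneg_left (le_max_left _ _) (abs_nonneg _)
    have := le_abs_self (v i * (g i * tOf w + b i * sOf w))
    rw [abs_mul] at this
    linarith
  have h2 : ∑ i, |v i| * u i ≤ ‖v‖ * ‖u‖ := by
    have := Real.sum_mul_le_sqrt_mul_sqrt Finset.univ (fun i => |v i|) (fun i => u i)
    rw [EuclideanSpace.norm_eq, EuclideanSpace.norm_eq]
    simpa using this
  nlinarith [norm_nonneg v]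

/-- The slack is convex and, since `b ≥ 0`, vanishes at the origin. -/
theorem norm_slack_mul_le {b g : Fin m → ℝ} (hb : ∀ i, 0 ≤ b i) (t s : ℝ) {l : ℝ} (h0 : 0 ≤ l)
    (h1 : l ≤ 1) : ‖slack b g (l * t) (l * s)‖ ≤ l * ‖slack b g t s‖ := by
  have : l * ‖slack b g t s‖ = ‖l • slack b g t s‖ := by
    rw [norm_smul, Real.norm_of_nonneg h0]
  rw [this, EuclideanSpace.norm_eq, EuclideanSpace.norm_eq]
  refine Real.sqrt_le_sqrt (Finset.sum_le_sum fun i _ => ?_)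
  rw [PiLp.smul_apply, slack_apply, slack_apply, smul_eq_mul, Real.norm_eq_abs, Real.norm_eq_abs]
  refine pow_le_pow_left₀ (abs_nonneg _) (abs_le_abs_of_nonneg (le_max_right _ _) ?_) 2
  refine max_le ?_ (mul_nonneg h0 (le_max_right _ _))
  have e : g i * (l * t) + b i * (l * s) = l * (g i * t + b i * s) := by ring
  rw [e, abs_mul, abs_of_nonneg h0]
  have h2 : l * (|g i * t + b i * s| - b i) ≤ l * max (|g i * t + b i * s| - b i) 0 :=
    mul_le_mul_of_nonneg_left (le_max_left _ _) h0
  have := hb i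
  nlinarith

theorem abs_norm_slack_sub_le (b g : Fin m → ℝ) (t s t' s' : ℝ) :
    |‖slack b g t s‖ - ‖slack b g t' s'‖| ≤
      |t - t'| * ‖(WithLp.toLp 2 g : EuclideanSpace ℝ (Fin m))‖ +
        |s - s'| * ‖(WithLp.toLp 2 b : EuclideanSpace ℝ (Fin m))‖ := by
  refine (abs_norm_sub_norm_le _ _).trans ?_
  set G : EuclideanSpace ℝ (Fin m) := WithLp.toLp 2 fun i => |g i|
  set B : EuclideanSpace ℝ (Fin m) := WithLp.toLp 2 fun i => |b i|
  have hG : ‖G‖ = ‖(WithLp.toLp 2 g : EuclideanSpace ℝ (Fin m))‖ := by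
    simp [EuclideanSpace.norm_eq, G]
  have hB : ‖B‖ = ‖(WithLp.toLp 2 b : EuclideanSpace ℝ (Fin m))‖ := by
    simp [EuclideanSpace.norm_eq, B]
  have key : ‖slack b g t s - slack b g t' s'‖ ≤ ‖|t - t'| • G + |s - s'| • B‖ := by
    rw [EuclideanSpace.norm_eq, EuclideanSpace.norm_eq]
    refine Real.sqrt_le_sqrt (Finset.sum_le_sum fun i _ => ?_)
    rw [Real.norm_eq_abs, Real.norm_eq_abs]
    refine pow_le_pow_left₀ (abs_nonneg _) ?_ 2
    have e : (|t - t'| • G + |s - s'| • B) i = |t - t'| * |g i| + |s - s'| * |b i| := rfl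
    rw [e, abs_of_nonneg (show 0 ≤ |t - t'| * |g i| + |s - s'| * |b i| by positivity),
      PiLp.sub_apply, slack_apply, slack_apply]
    refine (abs_max_sub_max_le_abs _ _ _).trans ?_
    have e2 : |g i * t + b i * s| - b i - (|g i * t' + b i * s'| - b i) =
      |g i * t + b i * s| - |g i * t' + b i * s'| := by ring
    rw [e2]
    refine (abs_abs_sub_abs_le _ _).trans ?_
    have e3 : g i * t + b i * s - (g i * t' + b i * s') = (t - t') * g i + (s - s') * b i := by
      ring
    rw [e3, ← abs_mul, ← abs_mul]
    exact abs_add_le _ _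
  refine key.trans ((norm_add_le _ _).trans ?_)
  rw [norm_smul, norm_smul, hG, hB, Real.norm_eq_abs, Real.norm_eq_abs, abs_abs, abs_abs]

/-! ### Maximizing a linear form under one linear constraint on a sphere -/

section Sphere

variable {E : Type*} [NormedAddCommGroup E] [InnerProductSpace ℝ E]

theorem norm_sub_inner_smul_sq (a x : E) (ha : ‖a‖ = 1) :
    ‖x - inner ℝ a x • a‖ ^ 2 = ‖x‖ ^ 2 - (inner ℝ a x) ^ 2 := by
  rw [norm_sub_sq_real, norm_smul, ha, inner_smul_right, real_inner_comm a x, Real.norm_eq_abs]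
  rw [mul_one, sq_abs, real_inner_comm]
  ring

theorem inner_le_of_le_abs_inner (a y w : E) (ha : ‖a‖ = 1) {τ : ℝ} (h0 : 0 ≤ τ)
    (hτ : τ ≤ |inner ℝ a w|) :
    inner ℝ y w ≤ ‖w‖ * |inner ℝ a y| + ‖y‖ * √(‖w‖ ^ 2 - τ ^ 2) := by
  have h1 : inner ℝ y w = inner ℝ a w * inner ℝ a y + inner ℝ y (w - inner ℝ a w • a) := by
    rw [inner_sub_right, inner_smul_right, real_inner_comm a y]; ring
  have h2 : ‖w - inner ℝ a w • a‖ ≤ √(‖w‖ ^ 2 - τ ^ 2) := by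
    refine Real.le_sqrt_of_sq_le ?_
    rw [norm_sub_inner_smul_sq a w ha]
    have := pow_le_pow_left₀ h0 hτ 2
    rw [sq_abs] at this
    linarith
  have h3 : inner ℝ a w * inner ℝ a y ≤ ‖w‖ * |inner ℝ a y| := by
    refine (le_abs_self _).trans ?_
    rw [abs_mul]
    refine mul_le_mul_of_nonneg_right ?_ (abs_nonneg _)
    simpa [ha] using abs_real_inner_le_norm a w
  have h4 := (real_inner_le_norm y (w - inner ℝ a w • a)).trans
    (mul_le_mul_of_nonneg_left h2 (norm_nonneg y))
  linarith

/-- Up to the error `2 t |⟪a, y⟫|` the bound of `inner_le_of_le_abs_inner` is attained by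
`-τ a + √(t² - τ²) z / ‖z‖`, where `z` is the component of `y` orthogonal to `a`. -/
theorem exists_norm_eq_inner_le (a y : E) (ha : ‖a‖ = 1) {t τ : ℝ} (h0 : 0 ≤ τ) (hτ : τ ≤ t) :
    ∃ w : E, ‖w‖ = t ∧ inner ℝ a w ≤ -τ ∧
      ‖y‖ * √(t ^ 2 - τ ^ 2) - 2 * t * |inner ℝ a y| ≤ inner ℝ y w := by
  have ht : 0 ≤ t := h0.trans hτ
  have hr : √(t ^ 2 - τ ^ 2) ≤ t := Real.sqrt_le_iff.2 ⟨ht, by nlinarith⟩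
  have hr0 := Real.sqrt_nonneg (t ^ 2 - τ ^ 2)
  have haa : inner ℝ a a = 1 := by rw [real_inner_self_eq_norm_sq, ha]; norm_num
  have hab := neg_abs_le (inner ℝ a y)
  have hab' := le_abs_self (inner ℝ a y)
  set z := y - inner ℝ a y • a with hz
  have hyz : ‖y‖ ≤ ‖z‖ + |inner ℝ a y| := by
    have : y = z + inner ℝ a y • a := by rw [hz]; abel
    calc ‖y‖ = ‖z + inner ℝ a y • a‖ := by rw [← this]
      _ ≤ ‖z‖ + ‖inner ℝ a y • a‖ := norm_add_le _ _
      _ = ‖z‖ + |inner ℝ a y| := by rw [norm_smul, ha, mul_one, Real.norm_eq_abs]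
  have haz : inner ℝ a z = 0 := by rw [hz, inner_sub_right, inner_smul_right, haa]; ring
  by_cases hz0 : z = 0
  · -- here `y` is a multiple of `a`, and the bound on `⟪y, w⟫` is too weak to need a direction
    refine ⟨(-t) • a, by rw [norm_smul, ha, mul_one, norm_neg, Real.norm_of_nonneg ht], ?_, ?_⟩
    · rw [inner_smul_right, haa]; linarith
    · rw [inner_smul_right, real_inner_comm a y]
      rw [hz0, norm_zero, zero_add] at hyz
      have h1 := mul_le_mul hyz hr hr0 (abs_nonneg _)
      have h2 := mul_le_mul_of_nonneg_left hab' ht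
      linarith
  · have hzn : 0 < ‖z‖ := norm_pos_iff.2 hz0
    set r := √(t ^ 2 - τ ^ 2) with hrdef
    have hr2 : r ^ 2 = t ^ 2 - τ ^ 2 := Real.sq_sqrt (by nlinarith)
    have hyz2 : inner ℝ y z = ‖z‖ ^ 2 := by
      have e : inner ℝ z z = inner ℝ y z - inner ℝ a y * inner ℝ a z := by
        conv_lhs => rw [hz]
        rw [inner_sub_left, inner_smul_left, ← hz]; simp
      rw [haz, mul_zero, sub_zero, real_inner_self_eq_norm_sq] at e
      exact e.symm
    refine ⟨(-τ) • a + (r / ‖z‖) • z, ?_, ?_, ?_⟩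
    · rw [← pow_left_inj₀ (norm_nonneg _) ht two_ne_zero, norm_add_sq_real, inner_smul_left,
        inner_smul_right, haz, norm_smul, norm_smul, ha, Real.norm_eq_abs, Real.norm_eq_abs,
        abs_of_nonneg (show 0 ≤ r / ‖z‖ by positivity), div_mul_cancel₀ _ hzn.ne', mul_one, sq_abs,
        hr2]
      simp
    · rw [inner_add_right, inner_smul_right, inner_smul_right, haz, haa]
      linarith
    · rw [inner_add_right, inner_smul_right, inner_smul_right, hyz2, real_inner_comm a y]
      have : r / ‖z‖ * ‖z‖ ^ 2 = r * ‖z‖ := by field_simp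
      rw [this]
      have h3 : ‖y‖ * r ≤ (‖z‖ + |inner ℝ a y|) * r := mul_le_mul_of_nonneg_right hyz hr0
      have h4 : |inner ℝ a y| * r ≤ |inner ℝ a y| * t :=
        mul_le_mul_of_nonneg_left hr (abs_nonneg _)
      have h5 : τ * inner ℝ a y ≤ t * |inner ℝ a y| :=
        (mul_le_mul_of_nonneg_left hab' h0).trans (mul_le_mul_of_nonneg_right hτ (abs_nonneg _))
      linarith

end Sphere

/-! ### Coordinates -/

theorem sum_mul_eq (x w : EuclideanSpace ℝ (Fin (k + 1) ⊕ Fin k)) :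
    ∑ l, x l * w l = x (Sum.inl 0) * headEntry w + inner ℝ (tailPart x) (tailPart w) := by
  rw [PiLp.inner_apply, Fintype.sum_sum_type, Fintype.sum_sum_type, Fin.sum_univ_succ]
  simp [headEntry, tailPart, mul_comm, add_assoc]

theorem sum_mul_eq_inner {ι : Type*} [Fintype ι] (h : ι → ℝ) (u : EuclideanSpace ℝ ι) :
    ∑ l, h l * u l = inner ℝ (WithLp.toLp 2 h : EuclideanSpace ℝ ι) u := by
  rw [PiLp.inner_apply]
  simp [mul_comm]

theorem norm_sq_eq_headEntry (w : EuclideanSpace ℝ (Fin (k + 1) ⊕ Fin k)) :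
    ‖w‖ ^ 2 = headEntry w ^ 2 + tOf w ^ 2 := by
  have := sum_mul_eq w w
  rw [real_inner_self_eq_norm_sq] at this
  rw [EuclideanSpace.norm_sq_eq, tOf, sq (headEntry w)]
  simp only [Real.norm_eq_abs, sq_abs]
  simp only [sq] at this ⊢
  exact this

theorem exists_sOf_eq (s : ℝ) (u : EuclideanSpace ℝ (Fin k ⊕ Fin k)) :
    ∃ w : EuclideanSpace ℝ (Fin (k + 1) ⊕ Fin k), sOf w = s ∧ tailPart w = u := by
  refine ⟨WithLp.toLp 2 (Sum.elim (Fin.cons (s - 1) fun i => u (Sum.inl i))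
    fun i => u (Sum.inr i)), ?_, ?_⟩
  · simp [sOf, headEntry]
  · ext l
    rcases l with i | i <;> simp [tailPart]

theorem continuous_tailPart :
    Continuous (tailPart : EuclideanSpace ℝ (Fin (k + 1) ⊕ Fin k) → _) := by
  unfold tailPart
  refine (PiLp.continuous_toLp 2 _).comp (continuous_pi fun l => ?_)
  rcases l with i | i <;> simp only [Sum.elim_inl, Sum.elim_inr] <;> fun_prop

theorem isClosed_aoFeasible (b g : Fin m → ℝ) (h : Fin k ⊕ Fin k → ℝ) :
    IsClosed {w : EuclideanSpace ℝ (Fin (k + 1) ⊕ Fin k) | AOFeasible b g h w} := by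
  unfold AOFeasible
  rw [ofPred_forall]
  refine isClosed_iInter fun v => isClosed_le ?_ continuous_const
  have h1 : Continuous fun w : EuclideanSpace ℝ (Fin (k + 1) ⊕ Fin k) => tailPart w :=
    continuous_tailPart
  have h2 : Continuous fun w : EuclideanSpace ℝ (Fin (k + 1) ⊕ Fin k) => sOf w := by
    unfold sOf headEntry; fun_prop
  have h3 : Continuous fun w : EuclideanSpace ℝ (Fin (k + 1) ⊕ Fin k) => tOf w := h1.norm
  have h4 : Continuous fun w : EuclideanSpace ℝ (Fin (k + 1) ⊕ Fin k) =>
      ∑ l, h l * tailPart w l :=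
    continuous_finsetSum _ fun l _ =>
      continuous_const.mul ((EuclideanSpace.proj (𝕜 := ℝ) l).continuous.comp h1)
  fun_prop

/-! ### From uniform closeness of the constraints to closeness of the optimizers -/

/-- The deterministic comparison: on the box `[0, 5] × [-5, 5]` the normalized constraint function
`‖slack‖ / ‖h‖` of (AO) is `μ`-close to `q`, and `h` is almost orthogonal to the tail of `η`.
The value of (AO) is compared with the deterministic one up to `6 μ` from above and `11 μ` from below, whence the factor `34 = 2 * 17`
against the tolerance `γ / 2`. -/
theorem optimizer_close {δ ρ t₀ s₀ ε γ μ t₁ s₁ : ℝ} (hδ : 4 < δ)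
    {b g : Fin m → ℝ} {h : Fin k ⊕ Fin k → ℝ} {η : EuclideanSpace ℝ (Fin (k + 1) ⊕ Fin k)}
    (hb : ∀ i, 0 ≤ b i) (hη₀ : η (Sum.inl 0) = ρ) (hη₁ : ‖tailPart η‖ = √(1 - ρ ^ 2))
    (hstable : ∀ t ∈ Icc (0 : ℝ) 5, ∀ s ∈ Icc (-5 : ℝ) 5, qFun δ t s ≤ t + γ →
      (t < 5 ∧ |s| < 5) ∧
      (detObjective δ ρ t₀ s₀ - γ ≤ detObjective δ ρ t s → |t - t₀| < ε ∧ |s - s₀| < ε))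
    (ht₁ : 0 ≤ t₁) (hq₁ : qFun δ t₁ s₁ + μ ≤ t₁)
    (ho₁ : detObjective δ ρ t₀ s₀ - γ / 2 ≤ detObjective δ ρ t₁ s₁)
    (hμ : 0 < μ) (hμγ : 34 * μ ≤ γ)
    (hh : 0 < ‖(WithLp.toLp 2 h : EuclideanSpace ℝ (Fin k ⊕ Fin k))‖)
    (hclose : ∀ t ∈ Icc (0 : ℝ) 5, ∀ s ∈ Icc (-5 : ℝ) 5,
      |‖slack b g t s‖ / ‖(WithLp.toLp 2 h : EuclideanSpace ℝ (Fin k ⊕ Fin k))‖ - qFun δ t s| ≤ μ ∧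
      |√(t ^ 2 - (‖slack b g t s‖ / ‖(WithLp.toLp 2 h : EuclideanSpace ℝ (Fin k ⊕ Fin k))‖) ^ 2) -
        √(t ^ 2 - qFun δ t s ^ 2)| ≤ μ)
    (horth : |∑ l, h l * tailPart η l| ≤
      μ * ‖(WithLp.toLp 2 h : EuclideanSpace ℝ (Fin k ⊕ Fin k))‖) :
    (∃ w, IsAOOptimizer η b g h w) ∧
      ∀ w, IsAOOptimizer η b g h w → |tOf w - t₀| < ε ∧ |sOf w - s₀| < ε := by
  set hv : EuclideanSpace ℝ (Fin k ⊕ Fin k) := WithLp.toLp 2 h with hhv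
  set N := ‖hv‖ with hN
  set a := N⁻¹ • hv with ha
  have ha1 : ‖a‖ = 1 := by
    rw [ha, norm_smul, Real.norm_of_nonneg (inv_nonneg.2 hh.le), ← hN, inv_mul_cancel₀ hh.ne']
  have hinner : ∀ u : EuclideanSpace ℝ (Fin k ⊕ Fin k), ∑ l, h l * u l = N * inner ℝ a u := by
    intro u
    rw [sum_mul_eq_inner, ← hhv, ha, real_inner_smul_left, ← mul_assoc, mul_inv_cancel₀ hh.ne',
      one_mul]
  have hay : |inner ℝ a (tailPart η)| ≤ μ := by
    rw [hinner, abs_mul, abs_of_pos hh, mul_comm] at horth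
    exact le_of_mul_le_mul_right horth hh
  have hσ1 : √(1 - ρ ^ 2) ≤ 1 := by
    rw [Real.sqrt_le_one]; nlinarith [sq_nonneg ρ]
  have hσ0 := Real.sqrt_nonneg (1 - ρ ^ 2)
  have hval : ∀ w : EuclideanSpace ℝ (Fin (k + 1) ⊕ Fin k),
      ∑ l, η l * w l = ρ * sOf w - ρ + inner ℝ (tailPart η) (tailPart w) := by
    intro w
    rw [sum_mul_eq, hη₀, sOf]; ring
  -- the constraint in normalized form
  have hτ : ∀ w, AOFeasible b g h w →
      ‖slack b g (tOf w) (sOf w)‖ / N ≤ |inner ℝ a (tailPart w)| := by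
    intro w hw
    have := hw.norm_slack_le
    rw [hinner, abs_mul, abs_of_pos hh] at this
    rwa [div_le_iff₀ hh, mul_comm]
  have hτt : ∀ w, AOFeasible b g h w → ‖slack b g (tOf w) (sOf w)‖ ≤ tOf w * N := by
    intro w hw
    rw [← div_le_iff₀ hh]
    refine (hτ w hw).trans ?_
    simpa [ha1, tOf] using abs_real_inner_le_norm a (tailPart w)
  -- feasible points lie in the box, by scaling back to its boundary
  have hbox : ∀ w, AOFeasible b g h w → tOf w ∈ Icc (0 : ℝ) 5 ∧ sOf w ∈ Icc (-5 : ℝ) 5 := by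
    intro w hw
    have ht : 0 ≤ tOf w := norm_nonneg _
    by_contra hout
    set M := max (tOf w / 5) (|sOf w| / 5) with hM
    have hM1 : 1 < M := by
      by_contra! hc
      rw [hM, max_le_iff, div_le_one (by norm_num), div_le_one (by norm_num), abs_le] at hc
      exact hout ⟨⟨ht, hc.1⟩, hc.2⟩
    have hM0 : 0 < M := by linarith
    have h1 : M⁻¹ * tOf w ≤ 5 := by
      rw [inv_mul_le_iff₀ hM0]
      have := le_max_left (tOf w / 5) (|sOf w| / 5)
      rw [← hM] at this
      linarith
    have h2 : M⁻¹ * |sOf w| ≤ 5 := by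
      rw [inv_mul_le_iff₀ hM0]
      have := le_max_right (tOf w / 5) (|sOf w| / 5)
      rw [← hM] at this
      linarith
    have h2' : |M⁻¹ * sOf w| = M⁻¹ * |sOf w| := by
      rw [abs_mul, abs_of_pos (inv_pos.2 hM0)]
    have hs' := abs_le.1 (h2'.trans_le h2)
    have ht' : M⁻¹ * tOf w ∈ Icc (0 : ℝ) 5 := ⟨by positivity, h1⟩
    have hsl := norm_slack_mul_le hb (g := g) (tOf w) (sOf w) (inv_nonneg.2 hM0.le)
      (inv_le_one_of_one_le₀ hM1.le)
    have h3 : ‖slack b g (M⁻¹ * tOf w) (M⁻¹ * sOf w)‖ / N ≤ M⁻¹ * tOf w := by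
      rw [div_le_iff₀ hh, mul_assoc]
      exact hsl.trans (mul_le_mul_of_nonneg_left (hτt w hw) (inv_nonneg.2 hM0.le))
    have h4 := abs_le.1 (hclose _ ht' _ hs').1
    have h5 := (hstable _ ht' _ hs' (by linarith)).1
    rw [h2'] at h5
    rcases le_total (tOf w / 5) (|sOf w| / 5) with hle | hle
    · rw [max_eq_right hle] at hM
      have : M⁻¹ * |sOf w| = 5 := by
        rw [inv_mul_eq_iff_eq_mul₀ hM0.ne', hM]; ring
      linarith [h5.2]
    · rw [max_eq_left hle] at hM
      have : M⁻¹ * tOf w = 5 := by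
        rw [inv_mul_eq_iff_eq_mul₀ hM0.ne', hM]; ring
      linarith [h5.1]
  have hle : ∀ w, AOFeasible b g h w →
      ρ * sOf w + inner ℝ (tailPart η) (tailPart w) ≤
        detObjective δ ρ (tOf w) (sOf w) + 6 * μ := by
    intro w hw
    obtain ⟨ht, hs⟩ := hbox w hw
    have h1 := inner_le_of_le_abs_inner a (tailPart η) (tailPart w) ha1
      (div_nonneg (norm_nonneg _) hh.le) (hτ w hw)
    have h2 := (abs_le.1 (hclose _ ht _ hs).2).2
    rw [detObjective_eq (by linarith)]
    rw [hη₁] at h1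
    change inner ℝ (tailPart η) (tailPart w) ≤ tOf w * |inner ℝ a (tailPart η)| +
      √(1 - ρ ^ 2) * √(tOf w ^ 2 - (‖slack b g (tOf w) (sOf w)‖ / N) ^ 2) at h1
    have h3 : tOf w * |inner ℝ a (tailPart η)| ≤ 5 * μ :=
      mul_le_mul ht.2 hay (abs_nonneg _) (by norm_num)
    nlinarith
  -- a feasible point whose value is close to that of the deterministic program
  obtain ⟨w₁, hw₁, hv₁⟩ : ∃ w₁, AOFeasible b g h w₁ ∧ detObjective δ ρ t₁ s₁ - 11 * μ ≤
      ρ * sOf w₁ + inner ℝ (tailPart η) (tailPart w₁) := by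
    have hbd := bounds_of_qFun_le hδ ht₁ (show qFun δ t₁ s₁ ≤ t₁ by linarith)
    have hs := abs_le.1 hbd.1
    have ht5 : t₁ ∈ Icc (0 : ℝ) 5 := ⟨ht₁, by linarith⟩
    have hs5 : s₁ ∈ Icc (-5 : ℝ) 5 := ⟨by linarith, by linarith⟩
    obtain ⟨hc1, hc2⟩ := hclose _ ht5 _ hs5
    obtain ⟨u, hu1, hu2, hu3⟩ := exists_norm_eq_inner_le a (tailPart η) ha1
      (t := t₁) (τ := ‖slack b g t₁ s₁‖ / N) (div_nonneg (norm_nonneg _) hh.le)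
      (by linarith [(abs_le.1 hc1).2])
    obtain ⟨w, hws, hwt⟩ := exists_sOf_eq s₁ u
    have hwt' : tOf w = t₁ := by rw [tOf, hwt, hu1]
    refine ⟨w, AOFeasible.of_le ?_, ?_⟩
    · rw [hinner, hwt, hws, hwt']
      have := mul_le_mul_of_nonneg_left hu2 hh.le
      rwa [mul_neg, mul_div_cancel₀ _ hh.ne'] at this
    · rw [hwt, hws, detObjective_eq (by linarith)]
      rw [hη₁] at hu3
      have h2 := (abs_le.1 hc2).1
      have h3 : 2 * t₁ * |inner ℝ a (tailPart η)| ≤ 10 * μ :=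
        mul_le_mul (by linarith) hay (abs_nonneg _) (by norm_num)
      nlinarith
  refine ⟨?_, fun w hw => ?_⟩
  · have hcomp : IsCompact {w : EuclideanSpace ℝ (Fin (k + 1) ⊕ Fin k) | AOFeasible b g h w} := by
      refine Metric.isCompact_of_isClosed_isBounded (isClosed_aoFeasible b g h) ?_
      refine (Metric.isBounded_closedBall (x := 0) (r := 11)).subset fun w hw => ?_
      rw [mem_closedBall_zero_iff]
      obtain ⟨ht, hs⟩ := hbox w hw
      refine (pow_le_pow_iff_left₀ (norm_nonneg _) (by norm_num) two_ne_zero).1 ?_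
      rw [norm_sq_eq_headEntry]
      have e : headEntry w = sOf w - 1 := by rw [sOf]; ring
      rw [e]
      nlinarith [ht.1, ht.2, hs.1, hs.2]
    obtain ⟨w, hw, hmax⟩ := hcomp.exists_isMaxOn ⟨w₁, hw₁⟩
      (show ContinuousOn (fun w : EuclideanSpace ℝ (Fin (k + 1) ⊕ Fin k) => ∑ l, η l * w l) _ by
        fun_prop)
    exact ⟨w, (isAOOptimizer_iff hw₁).2 ⟨hw, fun w' hw' => hmax hw'⟩⟩
  · obtain ⟨hf, hopt⟩ := (isAOOptimizer_iff hw₁).1 hw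
    have h1 := hopt w₁ hw₁
    rw [hval, hval] at h1
    have h2 := hle w hf
    obtain ⟨ht, hs⟩ := hbox w hf
    have h3 := abs_le.1 (hclose _ ht _ hs).1
    have h4 := hτt w hf
    rw [← div_le_iff₀ hh] at h4
    exact (hstable _ ht _ hs (by linarith)).2 (by linarith)

end PhaseMax

/-! ### The Rayleigh law -/

namespace PhaseMax

/-- The real-valued Rayleigh density on the positive half-line. -/
noncomputable def rayleighPDF (c : ℝ≥0) (x : ℝ) : ℝ :=
  (Ioi 0).indicator (fun x : ℝ => x / c * Real.exp (-x ^ 2 / (2 * c))) x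

theorem rayleighPDF_nonneg (c : ℝ≥0) (x : ℝ) : 0 ≤ rayleighPDF c x := by
  unfold rayleighPDF
  refine indicator_nonneg (fun x hx => ?_) x
  have : (0 : ℝ) < x := hx
  positivity

@[fun_prop]
theorem measurable_rayleighPDF (c : ℝ≥0) : Measurable (rayleighPDF c) := by
  unfold rayleighPDF
  exact Measurable.indicator (by fun_prop) measurableSet_Ioi

theorem rayleigh_eq (c : ℝ≥0) :
    rayleigh c = volume.withDensity fun x => ENNReal.ofReal (rayleighPDF c x) := by
  rw [rayleigh, ← withDensity_indicator measurableSet_Ioi]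
  congr 1
  ext x
  by_cases hx : x ∈ Ioi (0 : ℝ) <;> simp [rayleighPDF, hx]

instance (c : ℝ≥0) : SFinite (rayleigh c) := by
  rw [rayleigh_eq]
  infer_instance

theorem ae_rayleigh_pos (c : ℝ≥0) : ∀ᵐ x ∂rayleigh c, 0 < x := by
  rw [rayleigh_eq, ae_withDensity_iff (by fun_prop)]
  refine Eventually.of_forall fun x hx => ?_
  by_contra h
  exact hx (by simp [rayleighPDF, h])

theorem integral_Ioi_pow_mul_exp {c : ℝ≥0} (hc : 0 < c) (q : ℕ) :
    ∫ x in Ioi (0 : ℝ), x ^ q * Real.exp (-x ^ 2 / (2 * c)) =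
      (1 / (2 * c : ℝ)) ^ (-((q : ℝ) + 1) / 2) * (1 / 2) * Real.Gamma (((q : ℝ) + 1) / 2) := by
  have hc' : (0 : ℝ) < c := hc
  rw [← integral_rpow_mul_exp_neg_mul_rpow two_pos (by linarith [(Nat.cast_nonneg q : (0 : ℝ) ≤ q)])
    (show (0 : ℝ) < 1 / (2 * c) by positivity)]
  refine setIntegral_congr_fun measurableSet_Ioi fun x _ => ?_
  simp only [Real.rpow_natCast, Real.rpow_two]
  congr 2
  ring

theorem integrableOn_Ioi_pow_mul_exp {c : ℝ≥0} (hc : 0 < c) (q : ℕ) :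
    IntegrableOn (fun x : ℝ => x ^ q * Real.exp (-x ^ 2 / (2 * c))) (Ioi 0) := by
  have hc' : (0 : ℝ) < c := hc
  have := integrable_rpow_mul_exp_neg_mul_sq (show (0 : ℝ) < 1 / (2 * c) by positivity)
    (s := q) (by linarith [(Nat.cast_nonneg q : (0 : ℝ) ≤ q)])
  refine (this.congr (Eventually.of_forall fun x => ?_)).integrableOn
  simp only [Real.rpow_natCast]
  congr 2
  ring

theorem isProbabilityMeasure_rayleigh {c : ℝ≥0} (hc : 0 < c) :
    IsProbabilityMeasure (rayleigh c) := by
  have hc' : (0 : ℝ) < c := hc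
  constructor
  rw [rayleigh, withDensity_apply _ MeasurableSet.univ, Measure.restrict_univ,
    ← ofReal_integral_eq_lintegral_ofReal]
  · rw [← ENNReal.ofReal_one]
    congr 1
    have h := integral_Ioi_pow_mul_exp hc 1
    have e : ∀ x : ℝ, x / c * Real.exp (-x ^ 2 / (2 * c)) =
        (1 / (c : ℝ)) * (x ^ 1 * Real.exp (-x ^ 2 / (2 * c))) := fun x => by ring
    simp_rw [e]
    rw [integral_const_mul, h]
    norm_num [Real.rpow_neg_one]
    field_simp
  · have := (integrableOn_Ioi_pow_mul_exp hc 1).const_mul (1 / (c : ℝ))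
    refine this.congr (Eventually.of_forall fun x => ?_)
    simp only
    ring
  · filter_upwards [self_mem_ae_restrict measurableSet_Ioi] with x hx
    have : (0 : ℝ) < x := hx
    simp only [Pi.zero_apply]
    positivity

theorem memLp_four_rayleigh {c : ℝ≥0} (hc : 0 < c) : MemLp (fun x : ℝ => x) 4 (rayleigh c) := by
  have hc' : (0 : ℝ) < c := hc
  rw [← integrable_norm_rpow_iff (by fun_prop) (by norm_num) (by norm_num), rayleigh,
    integrable_withDensity_iff (by fun_prop) (Eventually.of_forall fun x => ENNReal.ofReal_lt_top)]
  have := (integrableOn_Ioi_pow_mul_exp hc 5).const_mul (1 / (c : ℝ))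
  refine this.congr ?_
  filter_upwards [self_mem_ae_restrict measurableSet_Ioi] with x hx
  have hx' : (0 : ℝ) < x := hx
  rw [ENNReal.toReal_ofReal (by positivity)]
  have e : (ENNReal.toReal 4) = ((4 : ℕ) : ℝ) := by norm_num
  rw [e, Real.rpow_natCast, Real.norm_of_nonneg hx'.le]
  ring

/-- The law of one pair `(bᵢ, gᵢ)`. -/
noncomputable def pairLaw (c : ℝ≥0) : Measure (ℝ × ℝ) := (rayleigh c).prod (gaussianReal 0 c)

theorem isProbabilityMeasure_pairLaw {c : ℝ≥0} (hc : 0 < c) :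
    IsProbabilityMeasure (pairLaw c) := by
  have := isProbabilityMeasure_rayleigh hc
  unfold pairLaw
  infer_instance

/-! ### The second moment of the slack -/

/-- The angular integral of one of the two terms of the slack: for `θ₀ = arcsin (a / √(t² + a²))`, the
function `t sin θ - a cos θ = √(t² + a²) sin (θ - θ₀)` is nonnegative on `[θ₀, π/2]` only, where an
antiderivative is explicit. -/
theorem integral_cos_mul_posPart_sq {t : ℝ} (ht : 0 ≤ t) (a : ℝ) :
    ∫ θ in (-(Real.pi / 2))..(Real.pi / 2),
      Real.cos θ * (max (t * Real.sin θ - a * Real.cos θ) 0) ^ 2 = gap t a ^ 2 / 3 := by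
  have hcont : Continuous fun θ : ℝ =>
      Real.cos θ * (max (t * Real.sin θ - a * Real.cos θ) 0) ^ 2 := by fun_prop
  set r := √(t ^ 2 + a ^ 2) with hr
  have hr2 : r ^ 2 = t ^ 2 + a ^ 2 := Real.sq_sqrt (by positivity)
  rcases eq_or_lt_of_le (Real.sqrt_nonneg (t ^ 2 + a ^ 2)) with h0 | h0
  · rw [← hr] at h0
    have ht0 : t = 0 := by nlinarith
    have ha0 : a = 0 := by nlinarith
    subst ht0 ha0
    simp [gap]
  rw [← hr] at h0
  set θ₀ := Real.arcsin (a / r) with hθ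
  have har : a ^ 2 ≤ r ^ 2 := by nlinarith
  have har' := abs_le.1 (abs_le_of_sq_le_sq har h0.le)
  have hsin : Real.sin θ₀ = a / r :=
    Real.sin_arcsin (by rw [le_div_iff₀ h0]; linarith) (by rw [div_le_iff₀ h0]; linarith)
  have hcos : Real.cos θ₀ = t / r := by
    rw [hθ, Real.cos_arcsin]
    have : 1 - (a / r) ^ 2 = (t / r) ^ 2 := by
      field_simp
      linarith
    rw [this, Real.sqrt_sq (by positivity)]
  have hmem := Real.arcsin_mem_Icc (a / r)
  rw [← hθ] at hmem
  have hform : ∀ θ, t * Real.sin θ - a * Real.cos θ = r * Real.sin (θ - θ₀) := by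
    intro θ
    rw [Real.sin_sub, hsin, hcos]
    field_simp
  rw [← intervalIntegral.integral_add_adjacent_intervals (b := θ₀)
    (hcont.intervalIntegrable _ _) (hcont.intervalIntegrable _ _)]
  have hleft : ∫ θ in (-(Real.pi / 2))..θ₀,
      Real.cos θ * (max (t * Real.sin θ - a * Real.cos θ) 0) ^ 2 = 0 := by
    rw [intervalIntegral.integral_congr (g := fun _ => (0 : ℝ)), intervalIntegral.integral_zero]
    intro θ hθm
    rw [uIcc_of_le hmem.1] at hθm
    beta_reduce
    rw [max_eq_right, zero_pow two_ne_zero, mul_zero]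
    rw [hform]
    have := Real.sin_nonpos_of_nonpos_of_neg_pi_le (x := θ - θ₀) (by linarith [hθm.2])
      (by linarith [hθm.1, hmem.2])
    nlinarith
  have hright : ∫ θ in θ₀..(Real.pi / 2),
      Real.cos θ * (max (t * Real.sin θ - a * Real.cos θ) 0) ^ 2 =
      ∫ θ in θ₀..(Real.pi / 2), Real.cos θ * (t * Real.sin θ - a * Real.cos θ) ^ 2 := by
    refine intervalIntegral.integral_congr fun θ hθm => ?_
    rw [uIcc_of_le hmem.2] at hθm
    rw [max_eq_left]
    rw [hform]
    exact mul_nonneg h0.le (Real.sin_nonneg_of_nonneg_of_le_pi (by linarith [hθm.1])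
      (by linarith [hθm.2, hmem.1]))
  rw [hleft, hright, zero_add]
  have hderiv : ∀ θ : ℝ, HasDerivAt (fun θ => t ^ 2 * Real.sin θ ^ 3 / 3 +
      2 * a * t * Real.cos θ ^ 3 / 3 + a ^ 2 * (Real.sin θ - Real.sin θ ^ 3 / 3))
      (Real.cos θ * (t * Real.sin θ - a * Real.cos θ) ^ 2) θ := by
    intro θ
    have hs := Real.hasDerivAt_sin θ
    have hc := Real.hasDerivAt_cos θ
    have h := ((((hs.pow 3).const_mul (t ^ 2)).div_const 3).add
      (((hc.pow 3).const_mul (2 * a * t)).div_const 3)).add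
      ((hs.sub ((hs.pow 3).div_const 3)).const_mul (a ^ 2))
    convert! h using 1
    have := Real.sin_sq_add_cos_sq θ
    have e : Real.cos θ ^ 2 = 1 - Real.sin θ ^ 2 := by linarith
    push_cast
    ring_nf
    have e3 : Real.cos θ ^ 3 = Real.cos θ - Real.cos θ * Real.sin θ ^ 2 := by
      rw [pow_succ, e]; ring
    rw [e3]
    ring
  rw [intervalIntegral.integral_eq_sub_of_hasDerivAt (fun θ _ => hderiv θ)
    ((by fun_prop : Continuous fun θ : ℝ =>
      Real.cos θ * (t * Real.sin θ - a * Real.cos θ) ^ 2).intervalIntegrable _ _)]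
  rw [Real.sin_pi_div_two, Real.cos_pi_div_two, hsin, hcos, gap, ← hr]
  have ht2 : t ^ 2 = r ^ 2 - a ^ 2 := by linarith
  have ht4 : t ^ 4 = (r ^ 2 - a ^ 2) ^ 2 := by rw [← ht2]; ring
  field_simp
  ring_nf
  rw [ht4, ht2]
  ring

/-- The integrand `(|t g + s b| - b)₊²`. -/
noncomputable def slackSq (t s : ℝ) (x : ℝ × ℝ) : ℝ := (max (|x.2 * t + x.1 * s| - x.1) 0) ^ 2

theorem slackSq_eq {t s b g : ℝ} (hb : 0 ≤ b) : slackSq t s (b, g) =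
    (max (t * g - (1 - s) * b) 0) ^ 2 + (max (t * (-g) - (1 + s) * b) 0) ^ 2 := by
  have e1 : t * g - (1 - s) * b = (g * t + b * s) - b := by ring
  have e2 : t * (-g) - (1 + s) * b = -(g * t + b * s) - b := by ring
  unfold slackSq
  simp only
  rw [e1, e2]
  rcases le_total 0 (g * t + b * s) with h | h
  · rw [abs_of_nonneg h, max_eq_right (show -(g * t + b * s) - b ≤ 0 by linarith)]
    ring
  · rw [abs_of_nonpos h, max_eq_right (show g * t + b * s - b ≤ 0 by linarith)]
    ring

theorem slackSq_mul {r : ℝ} (hr : 0 ≤ r) (t s : ℝ) (x : ℝ × ℝ) :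
    slackSq t s (r * x.1, r * x.2) = r ^ 2 * slackSq t s x := by
  unfold slackSq
  simp only
  have e : r * x.2 * t + r * x.1 * s = r * (x.2 * t + x.1 * s) := by ring
  rw [e, abs_mul, abs_of_nonneg hr, ← mul_sub, ← mul_pow, mul_max_of_nonneg _ _ hr, mul_zero]

theorem integral_cos_mul_slackSq {t : ℝ} (ht : 0 ≤ t) (s : ℝ) :
    ∫ θ in Ioo (-Real.pi) Real.pi,
      (Ioi 0).indicator (fun x : ℝ => x) (Real.cos θ) * slackSq t s (Real.cos θ, Real.sin θ) =
      2 / 3 * pFun t s := by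
  have hpi := Real.pi_pos
  have hsub : Ioo (-(Real.pi / 2)) (Real.pi / 2) ⊆ Ioo (-Real.pi) Real.pi :=
    Ioo_subset_Ioo (by linarith) (by linarith)
  have h1 : ∫ θ in Ioo (-Real.pi) Real.pi,
      (Ioi 0).indicator (fun x : ℝ => x) (Real.cos θ) * slackSq t s (Real.cos θ, Real.sin θ) =
      ∫ θ in Ioo (-(Real.pi / 2)) (Real.pi / 2),
        Real.cos θ * slackSq t s (Real.cos θ, Real.sin θ) := by
    rw [setIntegral_eq_of_subset_of_forall_sdiff_eq_zero measurableSet_Ioo hsub]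
    · refine setIntegral_congr_fun measurableSet_Ioo fun θ hθ => ?_
      have : Real.cos θ ∈ Ioi (0 : ℝ) := Real.cos_pos_of_mem_Ioo hθ
      simp only [indicator_of_mem this]
    · rintro θ ⟨hθ, hn⟩
      have : Real.cos θ ∉ Ioi (0 : ℝ) := by
        rw [mem_Ioi, not_lt]
        rcases lt_or_ge θ 0 with hneg | hpos
        · rw [← Real.cos_neg]
          refine Real.cos_nonpos_of_pi_div_two_le_of_le ?_ (by linarith [hθ.1])
          by_contra! hc
          exact hn ⟨by linarith, by linarith⟩
        · refine Real.cos_nonpos_of_pi_div_two_le_of_le ?_ (by linarith [hθ.2])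
          by_contra! hc
          exact hn ⟨by linarith, hc⟩
      rw [indicator_of_notMem this, zero_mul]
  rw [h1, ← integral_Ioc_eq_integral_Ioo, ← intervalIntegral.integral_of_le (by linarith)]
  have h2 : ∫ θ in (-(Real.pi / 2))..(Real.pi / 2),
      Real.cos θ * slackSq t s (Real.cos θ, Real.sin θ) =
      ∫ θ in (-(Real.pi / 2))..(Real.pi / 2),
        (Real.cos θ * (max (t * Real.sin θ - (1 - s) * Real.cos θ) 0) ^ 2 +
         Real.cos (-θ) * (max (t * Real.sin (-θ) - (1 + s) * Real.cos (-θ)) 0) ^ 2) := by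
    refine intervalIntegral.integral_congr fun θ hθ => ?_
    rw [uIcc_of_le (by linarith)] at hθ
    rw [slackSq_eq (Real.cos_nonneg_of_mem_Icc hθ), Real.cos_neg, Real.sin_neg]
    ring
  rw [h2, intervalIntegral.integral_add, integral_cos_mul_posPart_sq ht,
    intervalIntegral.integral_comp_neg
      (fun θ => Real.cos θ * (max (t * Real.sin θ - (1 + s) * Real.cos θ) 0) ^ 2), neg_neg,
    integral_cos_mul_posPart_sq ht, pFun_eq]
  · ring
  · exact (by fun_prop : Continuous fun θ : ℝ =>
      Real.cos θ * (max (t * Real.sin θ - (1 - s) * Real.cos θ) 0) ^ 2).intervalIntegrable _ _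
  · exact (by fun_prop : Continuous fun θ : ℝ => Real.cos (-θ) *
      (max (t * Real.sin (-θ) - (1 + s) * Real.cos (-θ)) 0) ^ 2).intervalIntegrable _ _

/-- The second moment of the slack, which identifies `p`. -/
theorem integral_slackSq {c : ℝ≥0} (hc : 0 < c) {t : ℝ} (ht : 0 ≤ t) (s : ℝ) :
    ∫ x, slackSq t s x ∂pairLaw c = c * pFun t s := by
  have hc' : (0 : ℝ) < c := hc
  have hdens : pairLaw c = (volume : Measure (ℝ × ℝ)).withDensity
      fun z => ENNReal.ofReal (rayleighPDF c z.1) * gaussianPDF 0 c z.2 := by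
    rw [pairLaw, rayleigh_eq, gaussianReal_of_var_ne_zero 0 hc.ne',
      prod_withDensity (by fun_prop) (by fun_prop), Measure.volume_eq_prod]
  rw [hdens, integral_withDensity_eq_integral_toReal_smul (by fun_prop)
    (Eventually.of_forall fun x => ENNReal.mul_lt_top ENNReal.ofReal_lt_top
      (by unfold gaussianPDF; exact ENNReal.ofReal_lt_top)), ← integral_comp_polarCoord_symm]
  -- in polar coordinates the integrand is a product, by homogeneity of the slack
  have key : ∀ p ∈ polarCoord.target, p.1 • ((ENNReal.ofReal (rayleighPDF c (polarCoord.symm p).1) *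
      gaussianPDF 0 c (polarCoord.symm p).2).toReal • slackSq t s (polarCoord.symm p)) =
      ((1 / c * (√(2 * Real.pi * c))⁻¹) * (p.1 ^ 4 * Real.exp (-p.1 ^ 2 / (2 * c)))) *
      ((Ioi 0).indicator (fun x : ℝ => x) (Real.cos p.2) *
        slackSq t s (Real.cos p.2, Real.sin p.2)) := by
    rintro ⟨r, θ⟩ hp
    rw [polarCoord_target] at hp
    have hr : (0 : ℝ) < r := hp.1
    rw [polarCoord_symm_apply, ENNReal.toReal_mul,
      ENNReal.toReal_ofReal (rayleighPDF_nonneg c _), toReal_gaussianPDF]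
    simp only [smul_eq_mul]
    rw [slackSq_mul hr.le t s (Real.cos θ, Real.sin θ)]
    unfold rayleighPDF gaussianPDFReal
    by_cases hcos : Real.cos θ ∈ Ioi (0 : ℝ)
    · have h2 : r * Real.cos θ ∈ Ioi (0 : ℝ) := mul_pos hr hcos
      rw [indicator_of_mem hcos, indicator_of_mem h2]
      have hexp : Real.exp (-r ^ 2 / (2 * c)) = Real.exp (-(r * Real.cos θ) ^ 2 / (2 * c)) *
          Real.exp (-(r * Real.sin θ - 0) ^ 2 / (2 * c)) := by
        rw [← Real.exp_add, ← add_div]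
        congr 2
        have := Real.sin_sq_add_cos_sq θ
        linear_combination r ^ 2 * this
      rw [hexp]
      ring
    · have h2 : r * Real.cos θ ∉ Ioi (0 : ℝ) := by
        rw [mem_Ioi, not_lt] at hcos ⊢
        nlinarith
      rw [indicator_of_notMem hcos, indicator_of_notMem h2]
      ring
  rw [setIntegral_congr_fun (polarCoord.open_target.measurableSet) key, polarCoord_target,
    Measure.volume_eq_prod, setIntegral_prod_mul
      (fun r : ℝ => (1 / c * (√(2 * Real.pi * c))⁻¹) * (r ^ 4 * Real.exp (-r ^ 2 / (2 * c))))
      (fun θ : ℝ => (Ioi 0).indicator (fun x : ℝ => x) (Real.cos θ) *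
        slackSq t s (Real.cos θ, Real.sin θ)), integral_cos_mul_slackSq ht, integral_const_mul,
    integral_Ioi_pow_mul_exp hc 4]
  have hG : Real.Gamma (((4 : ℕ) + 1 : ℝ) / 2) = 3 / 4 * √Real.pi := by
    have := Real.Gamma_nat_add_half 2
    norm_num [Nat.doubleFactorial] at this ⊢
    rw [this]
    ring
  have hpow : (1 / (2 * c : ℝ)) ^ (-(((4 : ℕ) : ℝ) + 1) / 2) = (2 * c) ^ 2 * √(2 * c) := by
    rw [one_div, Real.inv_rpow (by positivity), ← Real.rpow_neg (by positivity)]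
    have e : -(-(((4 : ℕ) : ℝ) + 1) / 2) = ((2 : ℕ) : ℝ) + 1 / 2 := by norm_num
    rw [e, Real.rpow_add (by positivity), Real.rpow_natCast, Real.sqrt_eq_rpow]
  have hsq : √(2 * Real.pi * c) = √Real.pi * √(2 * c) := by
    rw [← Real.sqrt_mul Real.pi_pos.le]
    congr 1
    ring
  rw [hG, hpow, hsq]
  have h1 : 0 < √Real.pi := Real.sqrt_pos.2 Real.pi_pos
  have h2 : 0 < √(2 * (c : ℝ)) := Real.sqrt_pos.2 (by positivity)
  field_simp
  ring

/-! ### Square integrability -/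

theorem memLp_two_sq {α : Type*} [MeasurableSpace α] {ν : Measure α} {f : α → ℝ}
    (hf : MemLp f 4 ν) : MemLp (fun x => f x ^ 2) 2 ν := by
  rw [memLp_two_iff_integrable_sq (by have := hf.aestronglyMeasurable; fun_prop)]
  have : Integrable (fun x => ‖f x‖ ^ 4) ν :=
    MemLp.integrable_norm_pow (p := 4) (by exact_mod_cast hf) (by norm_num)
  refine this.congr (Eventually.of_forall fun x => ?_)
  simp only [Real.norm_eq_abs]
  rw [← pow_mul, ← abs_pow, abs_of_nonneg (by positivity)]

theorem memLp_four_fst {c : ℝ≥0} (hc : 0 < c) :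
    MemLp (fun x : ℝ × ℝ => x.1) 4 (pairLaw c) := by
  have := isProbabilityMeasure_rayleigh hc
  exact (memLp_four_rayleigh hc).comp_measurePreserving measurePreserving_fst

theorem memLp_four_snd {c : ℝ≥0} (hc : 0 < c) :
    MemLp (fun x : ℝ × ℝ => x.2) 4 (pairLaw c) := by
  have := isProbabilityMeasure_rayleigh hc
  exact (memLp_id_gaussianReal' 4 (by norm_num)).comp_measurePreserving measurePreserving_snd

theorem memLp_slackSq {c : ℝ≥0} (hc : 0 < c) (t s : ℝ) : MemLp (slackSq t s) 2 (pairLaw c) := by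
  refine memLp_two_sq (f := fun x : ℝ × ℝ => max (|x.2 * t + x.1 * s| - x.1) 0) ?_
  have h1 := (((memLp_four_snd hc).const_mul t).norm.add ((memLp_four_fst hc).const_mul s).norm).add
    (memLp_four_fst hc).norm
  refine h1.mono (by fun_prop) (Eventually.of_forall fun x => ?_)
  simp only [Pi.add_apply, Real.norm_eq_abs]
  rw [abs_of_nonneg (le_max_right _ _)]
  refine le_trans (max_le ?_ (by positivity)) (le_abs_self _)
  have := abs_add_le (x.2 * t) (x.1 * s)
  have h2 := neg_abs_le x.1
  rw [mul_comm x.2, mul_comm x.1] at this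
  rw [mul_comm x.2, mul_comm x.1]
  linarith

end PhaseMax

/-! ### Convergence in probability as a filter -/

namespace PhaseMax

section ProbFilter

variable {Ω : ℕ → Type*} [∀ j, MeasurableSpace (Ω j)]

/-- The filter of events of a sequence of probability spaces whose complements have probabilities
tending to `0`. Convergence in probability of random variables defined on different spaces is
convergence along this filter. The events need not be measurable; the measures are read as outer
measures. -/
def probFilter (P : ∀ j, Measure (Ω j)) : Filter (Σ j, Ω j) where
  sets := {S | Tendsto (fun j => P j {ω | (⟨j, ω⟩ : Σ j, Ω j) ∉ S}) atTop (𝓝 0)}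
  univ_sets := by simp
  sets_of_superset {S T} hS hST := by
    refine tendsto_of_tendsto_of_tendsto_of_le_of_le tendsto_const_nhds hS (fun _ => zero_le)
      fun j => measure_mono fun ω hω h => hω (hST h)
  inter_sets {S T} hS hT := by
    have hsum := Tendsto.add hS hT
    rw [add_zero] at hsum
    refine tendsto_of_tendsto_of_tendsto_of_le_of_le tendsto_const_nhds hsum (fun _ => zero_le)
      fun j => (measure_mono fun ω hω => ?_).trans (measure_union_le _ _)
    by_contra hc
    simp only [mem_union, mem_ofPred_eq, not_or, not_not] at hc
    exact hω hc

variable {P : ∀ j, Measure (Ω j)}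

theorem eventually_probFilter {p : (Σ j, Ω j) → Prop} :
    (∀ᶠ z in probFilter P, p z) ↔ Tendsto (fun j => P j {ω | ¬ p ⟨j, ω⟩}) atTop (𝓝 0) := Iff.rfl

theorem tendsto_fst_probFilter : Tendsto Sigma.fst (probFilter P) atTop := by
  intro S hS
  refine eventually_probFilter.2 (tendsto_const_nhds.congr' ?_)
  filter_upwards [hS] with j hj
  simp [hj]

theorem eventually_probFilter_of_ae {p : (Σ j, Ω j) → Prop}
    (h : ∀ j, ∀ᵐ ω ∂P j, p ⟨j, ω⟩) : ∀ᶠ z in probFilter P, p z := by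
  refine eventually_probFilter.2 (tendsto_const_nhds.congr fun j => ?_)
  exact (ae_iff.1 (h j)).symm

/-- The weak law of large numbers, by Chebyshev's inequality, for sums of independent variables
`Xᵢ` that are functions of the coordinates of a product measure. -/
theorem tendsto_sum_div_probFilter {α : Type*} [MeasurableSpace α] (ν : Measure α)
    [IsProbabilityMeasure ν] {ι : ℕ → Type*} [∀ j, Fintype (ι j)]
    (φ : ∀ j, Ω j → ι j → α) (hφ : ∀ j, MeasurePreserving (φ j) (P j) (Measure.pi fun _ => ν))
    (X : ∀ j, ι j → α → ℝ) (hX : ∀ j i, MemLp (X j i) 2 ν) (r : ℕ → ℝ) (e : ℝ)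
    (hr : ∀ᶠ j in atTop, 0 < r j)
    (hmean : Tendsto (fun j => (∑ i, ∫ x, X j i x ∂ν) / r j) atTop (𝓝 e))
    (hvar : Tendsto (fun j => (∑ i, Var[X j i; ν]) / r j ^ 2) atTop (𝓝 0)) :
    Tendsto (fun z : Σ j, Ω j => (∑ i, X z.1 i (φ z.1 z.2 i)) / r z.1) (probFilter P) (𝓝 e) := by
  rw [Metric.tendsto_nhds]
  intro ε hε
  have h1 : ∀ᶠ z : Σ j, Ω j in probFilter P, |(∑ i, ∫ x, X z.1 i x ∂ν) / r z.1 - e| < ε / 2 :=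
    tendsto_fst_probFilter.eventually
      (Metric.tendsto_nhds.1 hmean (ε / 2) (by positivity))
  have h2 : ∀ᶠ z : Σ j, Ω j in probFilter P,
      |(∑ i, X z.1 i (φ z.1 z.2 i)) - ∑ i, ∫ x, X z.1 i x ∂ν| < ε / 2 * r z.1 := by
    rw [eventually_probFilter]
    have hlim : Tendsto (fun j => ENNReal.ofReal ((∑ i, Var[X j i; ν]) / (ε / 2 * r j) ^ 2))
        atTop (𝓝 0) := by
      have h := (hvar.const_mul (1 / (ε / 2) ^ 2))
      rw [mul_zero] at h
      have h' := ENNReal.tendsto_ofReal h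
      rw [ENNReal.ofReal_zero] at h'
      refine h'.congr fun j => ?_
      congr 1
      rw [mul_pow]
      field_simp
    refine tendsto_of_tendsto_of_tendsto_of_le_of_le' tendsto_const_nhds hlim
      (Eventually.of_forall fun _ => zero_le) ?_
    filter_upwards [hr] with j hj
    set μ := Measure.pi fun _ : ι j => ν with hμ
    let Y : (ι j → α) → ℝ := ∑ i, fun ω => X j i (ω i)
    have hXi : ∀ i, MemLp (fun ω : ι j → α => X j i (ω i)) 2 μ := fun i =>
      (hX j i).comp_measurePreserving (measurePreserving_eval (fun _ : ι j => ν) i)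
    have hY : MemLp Y 2 μ := memLp_finsetSum' _ fun i _ => hXi i
    have hYint : ∫ ω, Y ω ∂μ = ∑ i, ∫ x, X j i x ∂ν := by
      simp only [Y, Finset.sum_apply]
      rw [integral_finsetSum _ fun i _ => (hXi i).integrable one_le_two]
      exact Finset.sum_congr rfl fun i _ =>
        integral_comp_eval (μ := fun _ : ι j => ν) (hX j i).aestronglyMeasurable
    have hYvar : Var[Y; μ] = ∑ i, Var[X j i; ν] := variance_sum_pi fun i => hX j i
    have hcheb := meas_ge_le_variance_div_sq hY (show 0 < ε / 2 * r j by positivity)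
    rw [hYint, hYvar] at hcheb
    refine le_trans ?_ hcheb
    have hms : NullMeasurableSet {ω | ε / 2 * r j ≤ |Y ω - ∑ i, ∫ x, X j i x ∂ν|} μ := by
      have := hY.aestronglyMeasurable.aemeasurable
      exact nullMeasurableSet_le (by fun_prop) (by fun_prop)
    rw [← (hφ j).measure_preimage hms]
    refine measure_mono fun ω hω => ?_
    simp only [mem_ofPred_eq, not_lt] at hω
    simpa only [mem_preimage, mem_ofPred_eq, Y, Finset.sum_apply] using hω
  filter_upwards [h1, h2, tendsto_fst_probFilter.eventually hr] with z hz1 hz2 hz3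
  rw [Real.dist_eq]
  have : |((∑ i, X z.1 i (φ z.1 z.2 i)) - ∑ i, ∫ x, X z.1 i x ∂ν) / r z.1| < ε / 2 := by
    rw [abs_div, abs_of_pos hz3, div_lt_iff₀ hz3]
    exact hz2
  calc |(∑ i, X z.1 i (φ z.1 z.2 i)) / r z.1 - e|
      = |((∑ i, X z.1 i (φ z.1 z.2 i)) - ∑ i, ∫ x, X z.1 i x ∂ν) / r z.1 +
          ((∑ i, ∫ x, X z.1 i x ∂ν) / r z.1 - e)| := by congr 1; ring
    _ ≤ _ := abs_add_le _ _
    _ < ε := by linarith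

/-- The weak law of large numbers for identically distributed variables. -/
theorem tendsto_average_probFilter {α : Type*} [MeasurableSpace α] (ν : Measure α)
    [IsProbabilityMeasure ν] {ι : ℕ → Type*} [∀ j, Fintype (ι j)]
    (φ : ∀ j, Ω j → ι j → α) (hφ : ∀ j, MeasurePreserving (φ j) (P j) (Measure.pi fun _ => ν))
    {f : α → ℝ} (hf : MemLp f 2 ν)
    (hcard : Tendsto (fun j => (Fintype.card (ι j) : ℝ)) atTop atTop) :
    Tendsto (fun z : Σ j, Ω j => (∑ i, f (φ z.1 z.2 i)) / (Fintype.card (ι z.1) : ℝ))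
      (probFilter P) (𝓝 (∫ x, f x ∂ν)) := by
  have hpos := hcard.eventually_gt_atTop 0
  have hmean : Tendsto (fun j => (∑ _i : ι j, ∫ x, f x ∂ν) / (Fintype.card (ι j) : ℝ)) atTop
      (𝓝 (∫ x, f x ∂ν)) := by
    refine tendsto_const_nhds.congr' ?_
    filter_upwards [hpos] with j hj
    rw [Finset.sum_const, Finset.card_univ, nsmul_eq_mul, mul_div_cancel_left₀ _ hj.ne']
  have hvar : Tendsto (fun j => (∑ _i : ι j, Var[f; ν]) / (Fintype.card (ι j) : ℝ) ^ 2) atTop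
      (𝓝 0) := by
    have := (tendsto_inv_atTop_zero.comp hcard).const_mul (Var[f; ν])
    rw [mul_zero] at this
    refine this.congr' ?_
    filter_upwards [hpos] with j hj
    rw [Finset.sum_const, Finset.card_univ, nsmul_eq_mul, Function.comp]
    field_simp
  exact tendsto_sum_div_probFilter ν φ hφ (fun j _ => f) (fun _ _ => hf)
    (fun j => (Fintype.card (ι j) : ℝ)) _ hpos hmean hvar

end ProbFilter

/-! ### Limits of the random quantities in (AO) -/

section Limits

variable {c : ℝ≥0} {δ : ℝ} {m n : ℕ → ℕ}

theorem measurePreserving_pair (hc : 0 < c) (m k : ℕ) :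
    MeasurePreserving (fun (ω : (Fin m → ℝ) × (Fin m → ℝ) × (Fin k ⊕ Fin k → ℝ)) (i : Fin m) =>
      (ω.1 i, ω.2.1 i)) (aoLaw c m k) (Measure.pi fun _ => pairLaw c) := by
  have := isProbabilityMeasure_rayleigh hc
  have h1 := (measurePreserving_arrowProdEquivProdArrow ℝ ℝ (Fin m) (fun _ => rayleigh c)
    (fun _ => gaussianReal 0 c)).symm
  have h2 : MeasurePreserving
      (Prod.map id Prod.fst : (Fin m → ℝ) × (Fin m → ℝ) × (Fin k ⊕ Fin k → ℝ) → _)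
      (aoLaw c m k)
      ((Measure.pi fun _ => rayleigh c).prod (Measure.pi fun _ => gaussianReal 0 c)) :=
    (MeasurePreserving.id _).prod measurePreserving_fst
  exact h1.comp h2

theorem measurePreserving_noise (hc : 0 < c) (m k : ℕ) :
    MeasurePreserving (fun ω : (Fin m → ℝ) × (Fin m → ℝ) × (Fin k ⊕ Fin k → ℝ) => ω.2.2)
      (aoLaw c m k) (Measure.pi fun _ => gaussianReal 0 c) := by
  have := isProbabilityMeasure_rayleigh hc
  exact measurePreserving_snd.comp measurePreserving_snd

theorem ae_aoLaw_nonneg (hc : 0 < c) (m k : ℕ) : ∀ᵐ ω ∂aoLaw c m k, ∀ i, 0 ≤ ω.1 i := by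
  have := isProbabilityMeasure_rayleigh hc
  rw [ae_all_iff]
  intro i
  have h1 : MeasurePreserving
      (fun ω : (Fin m → ℝ) × (Fin m → ℝ) × (Fin k ⊕ Fin k → ℝ) => ω.1 i)
      (aoLaw c m k) (rayleigh c) :=
    (measurePreserving_eval (fun _ : Fin m => rayleigh c) i).comp measurePreserving_fst
  filter_upwards [h1.quasiMeasurePreserving.ae (ae_rayleigh_pos c)] with ω hω
  exact hω.le

/-- The sample space: for every `j` the data `(b, g, h)`. -/
abbrev Sample (m n : ℕ → ℕ) : Type :=
  Σ j, (Fin (m j) → ℝ) × (Fin (m j) → ℝ) × (Fin (n j) ⊕ Fin (n j) → ℝ)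

/-- The filter of events of probability tending to `1` under the laws of `(b, g, h)`. -/
noncomputable abbrev aoFilter (c : ℝ≥0) (m n : ℕ → ℕ) : Filter (Sample m n) :=
  probFilter fun j => aoLaw c (m j) (n j)

/-- The norm of the Gaussian vector `h`. -/
noncomputable def noiseNorm (z : Sample m n) : ℝ :=
  ‖(WithLp.toLp 2 z.2.2.2 : EuclideanSpace ℝ (Fin (n z.1) ⊕ Fin (n z.1)))‖

theorem noiseNorm_nonneg (z : Sample m n) : 0 ≤ noiseNorm z := norm_nonneg _

theorem tendsto_two_mul (hn : Tendsto n atTop atTop) :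
    Tendsto (fun j => 2 * (n j : ℝ)) atTop atTop :=
  (tendsto_natCast_atTop_atTop.comp hn).const_mul_atTop two_pos

theorem tendsto_ratio (hn : Tendsto n atTop atTop)
    (hmn : Tendsto (fun j => (m j : ℝ) / ((n j : ℝ) + 1)) atTop (𝓝 δ)) :
    Tendsto (fun j => (m j : ℝ) / (2 * (n j : ℝ))) atTop (𝓝 (δ / 2)) := by
  have h1 : Tendsto (fun j => 1 / 2 + 1 / (2 * (n j : ℝ))) atTop (𝓝 (1 / 2 + 0)) := by
    refine tendsto_const_nhds.add ?_
    simp only [one_div]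
    exact tendsto_inv_atTop_zero.comp (tendsto_two_mul hn)
  have h2 := hmn.mul h1
  have e : δ * (1 / 2 + 0) = δ / 2 := by ring
  rw [e] at h2
  refine h2.congr' ?_
  filter_upwards [(tendsto_two_mul hn).eventually_gt_atTop 0] with j hj
  have : (0 : ℝ) < n j := by linarith
  field_simp

theorem tendsto_card (hδ : 0 < δ) (hn : Tendsto n atTop atTop)
    (hmn : Tendsto (fun j => (m j : ℝ) / ((n j : ℝ) + 1)) atTop (𝓝 δ)) :
    Tendsto (fun j => (m j : ℝ)) atTop atTop := by
  have h := (tendsto_ratio hn hmn).pos_mul_atTop (half_pos hδ) (tendsto_two_mul hn)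
  refine h.congr' ?_
  filter_upwards [(tendsto_two_mul hn).eventually_gt_atTop 0] with j hj
  rw [div_mul_cancel₀ _ hj.ne']

theorem tendsto_noiseNorm_sq (hc : 0 < c) (hn : Tendsto n atTop atTop) :
    Tendsto (fun z : Sample m n => noiseNorm z ^ 2 / (2 * (n z.1 : ℝ))) (aoFilter c m n)
      (𝓝 (c : ℝ)) := by
  have h4 : MemLp (fun x : ℝ => x) 4 (gaussianReal 0 c) :=
    memLp_id_gaussianReal' 4 (by norm_num)
  have hcard : ∀ j, (Fintype.card (Fin (n j) ⊕ Fin (n j)) : ℝ) = 2 * (n j : ℝ) := by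
    intro j
    simp [two_mul]
  have h := tendsto_average_probFilter (P := fun j => aoLaw c (m j) (n j)) (gaussianReal 0 c)
    (fun j ω => ω.2.2) (fun j => measurePreserving_noise hc (m j) (n j)) (memLp_two_sq h4)
    (by simp only [hcard]; exact tendsto_two_mul hn)
  have hval : ∫ x, x ^ 2 ∂gaussianReal 0 c = c := by
    have h1 := variance_eq_sub (μ := gaussianReal 0 c) (X := id)
      (memLp_id_gaussianReal' 2 (by norm_num))
    rw [variance_id_gaussianReal] at h1
    simp only [id, integral_id_gaussianReal, Pi.pow_apply] at h1
    linarith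
  rw [hval] at h
  refine h.congr fun z => ?_
  rw [hcard, noiseNorm, EuclideanSpace.norm_sq_eq]
  simp

theorem eventually_noiseNorm_pos (hc : 0 < c) (hn : Tendsto n atTop atTop) :
    ∀ᶠ z : Sample m n in aoFilter c m n, 0 < noiseNorm z := by
  have hc' : (0 : ℝ) < c := hc
  filter_upwards [(tendsto_noiseNorm_sq hc hn).eventually (lt_mem_nhds hc')] with z hz
  by_contra hne
  have : noiseNorm z = 0 := le_antisymm (not_lt.1 hne) (norm_nonneg _)
  rw [this] at hz
  norm_num at hz

/-- A normalized linear statistic of `h` tends to `0`: its variance is at most `c / (2 n)`. -/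
theorem tendsto_noise_inner (hc : 0 < c) (hn : Tendsto n atTop atTop)
    (y : ∀ j, EuclideanSpace ℝ (Fin (n j) ⊕ Fin (n j))) (hy : ∀ j, ‖y j‖ ≤ 1) :
    Tendsto (fun z : Sample m n => (∑ l, z.2.2.2 l * y z.1 l) / noiseNorm z) (aoFilter c m n)
      (𝓝 0) := by
  have hc' : (0 : ℝ) < c := hc
  have h2 : MemLp (fun x : ℝ => x) 2 (gaussianReal 0 c) :=
    memLp_id_gaussianReal' 2 (by norm_num)
  have hv : Var[fun x : ℝ => x; gaussianReal 0 c] = c := variance_id_gaussianReal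
  have hm' : ∀ a : ℝ, ∫ x, a * x ∂gaussianReal 0 c = 0 := fun a => by
    rw [integral_const_mul, integral_id_gaussianReal, mul_zero]
  have hv' : ∀ a : ℝ, Var[fun x : ℝ => a * x; gaussianReal 0 c] = a ^ 2 * c := fun a => by
    rw [variance_const_mul a (fun x => x), hv]
  have hmean : Tendsto (fun j => (∑ l, ∫ x, y j l * x ∂gaussianReal 0 c) / √(2 * (n j : ℝ)))
      atTop (𝓝 0) := by
    simp only [hm', Finset.sum_const_zero, zero_div]
    exact tendsto_const_nhds
  have hvar : Tendsto (fun j => (∑ l, Var[fun x : ℝ => y j l * x; gaussianReal 0 c]) /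
      √(2 * (n j : ℝ)) ^ 2) atTop (𝓝 0) := by
    have hlim := (tendsto_inv_atTop_zero.comp (tendsto_two_mul hn)).const_mul (c : ℝ)
    rw [mul_zero] at hlim
    refine squeeze_zero (fun j => ?_) (fun j => ?_) hlim
    · exact div_nonneg (Finset.sum_nonneg fun i _ => variance_nonneg _ _) (sq_nonneg _)
    · simp only [hv', Function.comp]
      rw [← Finset.sum_mul, Real.sq_sqrt (by positivity), div_eq_mul_inv]
      refine mul_le_mul_of_nonneg_right ?_ (by positivity)
      have e : ∑ i, y j i ^ 2 = ‖y j‖ ^ 2 := by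
        rw [EuclideanSpace.norm_sq_eq]
        simp
      rw [e]
      have := pow_le_one₀ (norm_nonneg (y j)) (hy j) (n := 2)
      nlinarith
  have h := tendsto_sum_div_probFilter (P := fun j => aoLaw c (m j) (n j)) (gaussianReal 0 c)
    (fun j ω => ω.2.2) (fun j => measurePreserving_noise hc (m j) (n j))
    (fun j l x => y j l * x) (fun j l => h2.const_mul _) (fun j => √(2 * (n j : ℝ))) 0
    (by
      filter_upwards [(tendsto_two_mul hn).eventually_gt_atTop 0] with j hj
      exact Real.sqrt_pos.2 hj) hmean hvar
  have hN := ((tendsto_noiseNorm_sq (m := m) hc hn).sqrt).inv₀ (Real.sqrt_pos.2 hc').ne'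
  have hmul := h.mul hN
  rw [zero_mul] at hmul
  refine hmul.congr' ?_
  filter_upwards [tendsto_fst_probFilter.eventually
    ((tendsto_two_mul hn).eventually_gt_atTop 0), eventually_noiseNorm_pos hc hn] with z hz hz'
  rw [Real.sqrt_div (sq_nonneg _), Real.sqrt_sq hz'.le]
  have : 0 < √(2 * (n z.1 : ℝ)) := Real.sqrt_pos.2 hz
  simp only [mul_comm (y _ _)]
  field_simp

/-- Sums over the `m` measurements, normalized by `‖h‖²`. -/
theorem tendsto_sum_div_noiseNorm_sq (hc : 0 < c) (hδ : 0 < δ) (hn : Tendsto n atTop atTop)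
    (hmn : Tendsto (fun j => (m j : ℝ) / ((n j : ℝ) + 1)) atTop (𝓝 δ))
    {f : ℝ × ℝ → ℝ} (hf : MemLp f 2 (pairLaw c)) :
    Tendsto (fun z : Sample m n => (∑ i, f (z.2.1 i, z.2.2.1 i)) / noiseNorm z ^ 2)
      (aoFilter c m n) (𝓝 ((∫ x, f x ∂pairLaw c) * (δ / 2) / c)) := by
  have := isProbabilityMeasure_pairLaw hc
  have hc' : (0 : ℝ) < c := hc
  have hm := tendsto_card hδ hn hmn
  have h := tendsto_average_probFilter (P := fun j => aoLaw c (m j) (n j)) (pairLaw c)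
    (fun j ω i => (ω.1 i, ω.2.1 i)) (fun j => measurePreserving_pair hc (m j) (n j)) hf
    (by simpa using hm)
  have h2 := (h.mul ((tendsto_ratio hn hmn).comp tendsto_fst_probFilter)).div
    (tendsto_noiseNorm_sq hc hn) hc'.ne'
  refine h2.congr' ?_
  filter_upwards [tendsto_fst_probFilter.eventually
    ((tendsto_two_mul hn).eventually_gt_atTop 0), eventually_noiseNorm_pos hc hn,
    tendsto_fst_probFilter.eventually (hm.eventually_gt_atTop 0)] with z hz hz' hz''
  have hz0 : (0 : ℝ) < n z.1 := by linarith
  simp only [Function.comp, Fintype.card_fin, Pi.div_apply]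
  field_simp

/-- The normalized constraint function of (AO). -/
noncomputable def slackRatio (z : Sample m n) (t s : ℝ) : ℝ :=
  ‖slack z.2.1 z.2.2.1 t s‖ / noiseNorm z

theorem tendsto_slackRatio (hc : 0 < c) (hδ : 0 < δ) (hn : Tendsto n atTop atTop)
    (hmn : Tendsto (fun j => (m j : ℝ) / ((n j : ℝ) + 1)) atTop (𝓝 δ)) {t : ℝ} (ht : 0 ≤ t)
    (s : ℝ) :
    Tendsto (fun z : Sample m n => slackRatio z t s) (aoFilter c m n) (𝓝 (qFun δ t s)) := by
  have hc' : (0 : ℝ) < c := hc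
  have h := (tendsto_sum_div_noiseNorm_sq hc hδ hn hmn (memLp_slackSq hc t s)).sqrt
  rw [integral_slackSq hc ht] at h
  have e : (c : ℝ) * pFun t s * (δ / 2) / c = δ / 2 * pFun t s := by field_simp
  rw [e] at h
  refine h.congr fun z => ?_
  have e2 : ∑ i, slackSq t s (z.2.1 i, z.2.2.1 i) = ‖slack z.2.1 z.2.2.1 t s‖ ^ 2 := by
    rw [norm_sq_slack]
    rfl
  rw [e2, ← div_pow, Real.sqrt_sq (div_nonneg (norm_nonneg _) (noiseNorm_nonneg z))]
  rfl

theorem tendsto_norm_div_noiseNorm (hc : 0 < c) (hδ : 0 < δ) (hn : Tendsto n atTop atTop)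
    (hmn : Tendsto (fun j => (m j : ℝ) / ((n j : ℝ) + 1)) atTop (𝓝 δ)) :
    (∃ G : ℝ, Tendsto (fun z : Sample m n =>
      ‖(WithLp.toLp 2 z.2.2.1 : EuclideanSpace ℝ (Fin (m z.1)))‖ / noiseNorm z)
      (aoFilter c m n) (𝓝 G)) ∧
    ∃ B : ℝ, Tendsto (fun z : Sample m n =>
      ‖(WithLp.toLp 2 z.2.1 : EuclideanSpace ℝ (Fin (m z.1)))‖ / noiseNorm z)
      (aoFilter c m n) (𝓝 B) := by
  have hnorm : ∀ z : Sample m n, ∀ u : Fin (m z.1) → ℝ,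
      √((∑ i, u i ^ 2) / noiseNorm z ^ 2) =
        ‖(WithLp.toLp 2 u : EuclideanSpace ℝ (Fin (m z.1)))‖ / noiseNorm z := by
    intro z u
    have e : ∑ i, u i ^ 2 = ‖(WithLp.toLp 2 u : EuclideanSpace ℝ (Fin (m z.1)))‖ ^ 2 := by
      rw [EuclideanSpace.norm_sq_eq]
      simp
    rw [e, ← div_pow, Real.sqrt_sq (div_nonneg (norm_nonneg _) (noiseNorm_nonneg z))]
  exact ⟨⟨_, ((tendsto_sum_div_noiseNorm_sq hc hδ hn hmn
      (memLp_two_sq (memLp_four_snd hc))).sqrt).congr fun z => hnorm z z.2.2.1⟩,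
    ⟨_, ((tendsto_sum_div_noiseNorm_sq hc hδ hn hmn
      (memLp_two_sq (memLp_four_fst hc))).sqrt).congr fun z => hnorm z z.2.1⟩⟩

/-- Pointwise convergence of the Lipschitz functions `slackRatio` is locally uniform. -/
theorem tendsto_slackRatio_prod (hc : 0 < c) (hδ : 0 < δ) (hn : Tendsto n atTop atTop)
    (hmn : Tendsto (fun j => (m j : ℝ) / ((n j : ℝ) + 1)) atTop (𝓝 δ)) {x : ℝ × ℝ}
    (hx : 0 ≤ x.1) :
    Tendsto (fun y : Sample m n × ℝ × ℝ => slackRatio y.1 y.2.1 y.2.2) (aoFilter c m n ×ˢ 𝓝 x)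
      (𝓝 (qFun δ x.1 x.2)) := by
  obtain ⟨⟨G, hG⟩, B, hB⟩ := tendsto_norm_div_noiseNorm hc hδ hn hmn
  have hq := (tendsto_slackRatio hc hδ hn hmn hx x.2).comp
    (tendsto_fst (f := aoFilter c m n) (g := 𝓝 x))
  have hd1 : Tendsto (fun y : Sample m n × ℝ × ℝ => |y.2.1 - x.1|) (aoFilter c m n ×ˢ 𝓝 x)
      (𝓝 0) := by
    have h : Tendsto (fun u : ℝ × ℝ => |u.1 - x.1|) (𝓝 x) (𝓝 |x.1 - x.1|) :=
      (by fun_prop : Continuous fun u : ℝ × ℝ => |u.1 - x.1|).tendsto x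
    rw [sub_self, abs_zero] at h
    exact h.comp tendsto_snd
  have hd2 : Tendsto (fun y : Sample m n × ℝ × ℝ => |y.2.2 - x.2|) (aoFilter c m n ×ˢ 𝓝 x)
      (𝓝 0) := by
    have h : Tendsto (fun u : ℝ × ℝ => |u.2 - x.2|) (𝓝 x) (𝓝 |x.2 - x.2|) :=
      (by fun_prop : Continuous fun u : ℝ × ℝ => |u.2 - x.2|).tendsto x
    rw [sub_self, abs_zero] at h
    exact h.comp tendsto_snd
  have hbound := (hd1.mul (hG.comp tendsto_fst)).add (hd2.mul (hB.comp tendsto_fst))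
  rw [zero_mul, zero_mul, add_zero] at hbound
  have hdiff : Tendsto (fun y : Sample m n × ℝ × ℝ =>
      slackRatio y.1 y.2.1 y.2.2 - slackRatio y.1 x.1 x.2) (aoFilter c m n ×ˢ 𝓝 x) (𝓝 0) := by
    refine squeeze_zero_norm (fun y => ?_) hbound
    have hN : 0 ≤ noiseNorm y.1 := norm_nonneg _
    simp only [Function.comp]
    rw [Real.norm_eq_abs, slackRatio, slackRatio, ← sub_div, abs_div, abs_of_nonneg hN,
      ← mul_div_assoc, ← mul_div_assoc, ← add_div]
    exact div_le_div_of_nonneg_right (abs_norm_slack_sub_le _ _ _ _ _ _) hN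
  have := hdiff.add hq
  rw [zero_add] at this
  refine this.congr fun y => ?_
  simp only [Function.comp]
  ring

theorem eventually_slackRatio_close (hc : 0 < c) (hδ : 0 < δ) (hn : Tendsto n atTop atTop)
    (hmn : Tendsto (fun j => (m j : ℝ) / ((n j : ℝ) + 1)) atTop (𝓝 δ)) {μ : ℝ} (hμ : 0 < μ) :
    ∀ᶠ z : Sample m n in aoFilter c m n, ∀ t ∈ Icc (0 : ℝ) 5, ∀ s ∈ Icc (-5 : ℝ) 5,
      |slackRatio z t s - qFun δ t s| ≤ μ ∧
      |√(t ^ 2 - slackRatio z t s ^ 2) - √(t ^ 2 - qFun δ t s ^ 2)| ≤ μ := by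
  have hK : IsCompact (Icc (0 : ℝ) 5 ×ˢ Icc (-5 : ℝ) 5) := isCompact_Icc.prod isCompact_Icc
  have hS : ∀ x ∈ Icc (0 : ℝ) 5 ×ˢ Icc (-5 : ℝ) 5,
      ∀ᶠ y : Sample m n × ℝ × ℝ in aoFilter c m n ×ˢ 𝓝 x,
        |slackRatio y.1 y.2.1 y.2.2 - qFun δ y.2.1 y.2.2| ≤ μ ∧
        |√(y.2.1 ^ 2 - slackRatio y.1 y.2.1 y.2.2 ^ 2) -
          √(y.2.1 ^ 2 - qFun δ y.2.1 y.2.2 ^ 2)| ≤ μ := by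
    intro x hx
    have h1 := tendsto_slackRatio_prod hc hδ hn hmn hx.1.1
    have h2 : Tendsto (fun y : Sample m n × ℝ × ℝ => y.2.1) (aoFilter c m n ×ˢ 𝓝 x) (𝓝 x.1) :=
      (continuous_fst.tendsto x).comp tendsto_snd
    have h3 : Tendsto (fun y : Sample m n × ℝ × ℝ => qFun δ y.2.1 y.2.2) (aoFilter c m n ×ˢ 𝓝 x)
        (𝓝 (qFun δ x.1 x.2)) := ((continuous_qFun δ).tendsto x).comp tendsto_snd
    have hd : Tendsto (fun u : ℝ × ℝ × ℝ => (|u.1 - u.2.1|,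
        |√(u.2.2 ^ 2 - u.1 ^ 2) - √(u.2.2 ^ 2 - u.2.1 ^ 2)|))
        (𝓝 (qFun δ x.1 x.2, qFun δ x.1 x.2, x.1)) (𝓝 (0, 0)) := by
      have hcont : Continuous fun u : ℝ × ℝ × ℝ => (|u.1 - u.2.1|,
        |√(u.2.2 ^ 2 - u.1 ^ 2) - √(u.2.2 ^ 2 - u.2.1 ^ 2)|) := by fun_prop
      have := hcont.tendsto (qFun δ x.1 x.2, qFun δ x.1 x.2, x.1)
      simp only [sub_self, abs_zero] at this
      exact this
    have hmem : ∀ᶠ u : ℝ × ℝ in 𝓝 (0, 0), u.1 ≤ μ ∧ u.2 ≤ μ :=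
      prod_mem_nhds (Iic_mem_nhds hμ) (Iic_mem_nhds hμ)
    exact (hd.comp (h1.prodMk_nhds (h3.prodMk_nhds h2))).eventually hmem
  obtain ⟨p, hp, q, hq, hpq⟩ := eventually_prod_iff.1 (hK.mem_prod_nhdsSet_of_forall hS)
  exact hp.mono fun z hz t ht s hs =>
    hpq hz (y := (t, s)) (Eventually.self_of_nhdsSet hq (t, s) ⟨ht, hs⟩)

end Limits

/-! ### The direction of the initialization -/

theorem apply_zero_of_inner_single {k : ℕ} {x : EuclideanSpace ℂ (Fin (k + 1))} {ρ : ℝ}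
    (h : inner ℂ x (EuclideanSpace.single (0 : Fin (k + 1)) (1 : ℂ)) = (ρ : ℂ)) :
    x 0 = (ρ : ℂ) := by
  rw [EuclideanSpace.inner_single_right, one_mul] at h
  have := congrArg (starRingEnd ℂ) h
  simpa using this

theorem norm_tailPart_eta {k : ℕ} {x : EuclideanSpace ℂ (Fin (k + 1))} {ρ : ℝ} (hx : ‖x‖ = 1)
    (h : x 0 = (ρ : ℂ)) : ‖tailPart (eta x)‖ = √(1 - ρ ^ 2) := by
  have h1 : ‖eta x‖ ^ 2 = 1 := by
    have hx2 : ‖x‖ ^ 2 = 1 := by rw [hx, one_pow]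
    rw [← hx2, EuclideanSpace.norm_sq_eq, EuclideanSpace.norm_sq_eq,
      Fintype.sum_sum_type, Fin.sum_univ_succ (fun i => ‖x i‖ ^ 2),
      Fin.sum_univ_succ (fun i => ‖eta x (Sum.inl i)‖ ^ 2), add_assoc, ← Finset.sum_add_distrib]
    congr 1
    · simp [eta, h]
    · refine Finset.sum_congr rfl fun i _ => ?_
      rw [← Complex.normSq_eq_norm_sq, Complex.normSq_apply]
      simp [eta, sq]
  have h2 : headEntry (eta x) = ρ := by simp [headEntry, eta, h]
  rw [norm_sq_eq_headEntry, h2] at h1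
  change tOf (eta x) = _
  rw [← h1, add_sub_cancel_left, Real.sqrt_sq (show 0 ≤ tOf (eta x) from norm_nonneg _)]

end PhaseMax

theorem theorem2 (δ ρ : ℝ) (hδ : 4 < δ) (hρ : ρ ∈ Icc (0 : ℝ) 1) (c : ℝ≥0) (hc : 0 < c)
    (m n : ℕ → ℕ) (hn : Tendsto n atTop atTop)
    (hmn : Tendsto (fun j => (m j : ℝ) / ((n j : ℝ) + 1)) atTop (𝓝 δ))
    (xinit : ∀ j, EuclideanSpace ℂ (Fin (n j + 1)))
    (hnorm : ∀ j, ‖xinit j‖ = 1)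
    (halign : ∀ j, inner ℂ (xinit j) (EuclideanSpace.single (0 : Fin (n j + 1)) (1 : ℂ)) = (ρ : ℂ)) :
    (∃ t₀ s₀ : ℝ, IsUniqueDetSolution δ ρ t₀ s₀ ∧
      ∀ ε : ℝ, 0 < ε →
        Tendsto (fun j => aoLaw c (m j) (n j)
          {ω | ¬ ((∃ w, IsAOOptimizer (eta (xinit j)) ω.1 ω.2.1 ω.2.2 w) ∧
            ∀ w, IsAOOptimizer (eta (xinit j)) ω.1 ω.2.1 ω.2.2 w →
              |tOf w - t₀| < ε ∧ |sOf w - s₀| < ε)})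
          atTop (𝓝 0)) ∧
    (IsUniqueDetSolution δ ρ 0 1 ↔ 2 / √δ ≤ ρ) := by
  refine ⟨?_, isUniqueDetSolution_zero_one_iff hδ hρ⟩
  obtain ⟨t₀, s₀, hsol⟩ := exists_isDetSolution hδ ρ
  refine ⟨t₀, s₀, hsol.isUnique hδ hρ, fun ε hε => ?_⟩
  obtain ⟨γ, hγ, hstable⟩ := hsol.exists_stable hδ hρ hε
  obtain ⟨t₁, s₁, ht₁, hq₁, ho₁⟩ := hsol.exists_strict hδ (half_pos hγ)
  set μ := min (t₁ - qFun δ t₁ s₁) (γ / 34) with hμdef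
  have hμ : 0 < μ := lt_min (by linarith) (by positivity)
  have hμ1 : μ ≤ t₁ - qFun δ t₁ s₁ := min_le_left _ _
  have hμ2 : μ ≤ γ / 34 := min_le_right _ _
  have hx0 : ∀ j, xinit j 0 = (ρ : ℂ) := fun j => apply_zero_of_inner_single (halign j)
  have htail : ∀ j, ‖tailPart (eta (xinit j))‖ = √(1 - ρ ^ 2) := fun j =>
    norm_tailPart_eta (hnorm j) (hx0 j)
  have hnoise := (tendsto_noise_inner (m := m) hc hn (fun j => tailPart (eta (xinit j)))
    (fun j => by
      rw [htail, Real.sqrt_le_one]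
      nlinarith [sq_nonneg ρ])).abs
  rw [abs_zero] at hnoise
  refine (eventually_probFilter (P := fun j => aoLaw c (m j) (n j))
    (p := fun z => (∃ w, IsAOOptimizer (eta (xinit z.1)) z.2.1 z.2.2.1 z.2.2.2 w) ∧
      ∀ w, IsAOOptimizer (eta (xinit z.1)) z.2.1 z.2.2.1 z.2.2.2 w →
        |tOf w - t₀| < ε ∧ |sOf w - s₀| < ε)).1 ?_
  filter_upwards [eventually_probFilter_of_ae (P := fun j => aoLaw c (m j) (n j))
      (p := fun z => ∀ i, 0 ≤ z.2.1 i) (fun j => ae_aoLaw_nonneg hc (m j) (n j)),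
    eventually_noiseNorm_pos hc hn, hnoise.eventually (gt_mem_nhds hμ),
    eventually_slackRatio_close hc (by linarith) hn hmn hμ] with z hb hh horth hclose
  refine optimizer_close hδ hb (by simp [eta, hx0]) (htail z.1) hstable ht₁ (by linarith) ho₁.le hμ
    (by linarith) hh hclose ?_
  rw [abs_div, abs_of_pos hh, div_lt_iff₀ hh] at horth
  exact horth.le
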